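/- Let $n_1,n_2,n_3,F$ be nonnegative integers with $n_{\max}=\max\{n_1,n_2,n_3,F\}\ge 2$, put $N=n_1n_2n_3$, and let $m$ be a real number with $1\le m\le N$. For matrices $A\in\mathbb R^{n_1\times F}$, $B\in\mathbb R^{n_2\times F}$, $C\in\mathbb R^{n_3\times F}$ let $[A,B,C]$ be the tensor with entries $[A,B,C]_{i,j,k}=\sum_{f=1}^F A_{if}B_{jf}C_{kf}$, and let $\|C\|_0$ be the number of nonzero entries of $C$. *Observations.* Let $\nu$ be a $\sigma$-finite measure on a measurable space $\mathcal Y$ (for instance Lebesgue measure on $\mathbb R$) and let $(p_x)_{x\in\mathbb R}$ be a family of probability densities with respect to $\nu$. Let $\underline X^*\in\mathbb R^{n_1\times n_2\times n_3}$ be an arbitrary unknown tensor. A random set $S\subseteq[n_1]\times[n_2]\times[n_3]$ contains each index independently with probability $\gamma=m/N$; given $S$, the observations $Y_S=(Y_{i,j,k})_{(i,j,k)\in S}$ are independent with densities $p_{X^*_{i,j,k}}$. For a tensor $\underline X$ write $p_{\underline X_S}(Y_S)=\prod_{(i,j,k)\in S}p_{X_{i,j,k}}(Y_{i,j,k})$,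 and let $p_{\underline X}$ be the product density of observations of all $N$ entries. Further, $D(p\|q)=\mathbb E_p[\log(p/q)]$ is the Kullback–Leibler divergence ($+\infty$ if the law of $p$ is not absolutely continuous with respect to that of $q$), and $A(p,q)=\mathbb E_p[\sqrt{q/p}]$ the Hellinger affinity. *Candidates.* Let $\beta\ge 1$, let $A_{\max},B_{\max},C_{\max},X_{\max}$ be real numbers, and let $L=2^{\lceil \log_2 (n_{\max}^{\beta})\rceil}$. Let $\mathcal X$ be any nonempty set of factor triples $(A,B,C)$ such that every entry of $A$ (of $B$) is one of the $L$ uniformly spaced levels from $-A_{\max}$ to $A_{\max}$ (from $-B_{\max}$ to $B_{\max}$), every entry of $C$ is zero or one of the $L$ uniformly spaced levels from $-C_{\max}$ to $C_{\max}$, and $\max_{i,j,k}|[A,B,C]_{i,j,k}|\le X_{\max}$. We write $\underline X=[A,B,C]\in\mathcal X$ for the tensor of a triple in $\mathcal X$. Let $Q_D<\infty$ satisfy $$Q_D\ \ge\ \max_{\underline X\in\mathcal X}\max_{i,j,k}D\big(p_{X^*_{i,j,k}}\,\big\|\,p_{X_{i,j,k}}\big).$$ *Claim.* Suppose $\lambda\ge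 4(\beta+2)\left(1+\tfrac{2Q_D}{3}\right)\log n_{\max}$, and let $\underline{\hat X}=\underline{\hat X}(S,Y_S)$ be any (measurable) choice of $$\underline{\hat X}\in\operatorname*{arg\,min}_{\underline X=[A,B,C]\in\mathcal X}\left\{-\log p_{\underline X_S}(Y_S)+\lambda\|C\|_0\right\}\qquad(-\log 0=+\infty).$$ Then $D(p_{\underline X^*}\|p_{\underline X})<\infty$ and $A(p_{\underline X},p_{\underline X^*})>0$ for every $\underline X\in\mathcal X$, the random variable $-2\log A(p_{\underline{\hat X}},p_{\underline X^*})$ is integrable, and $$\frac{\mathbb E_{S,Y_S}\left[-2\log A(p_{\underline{\hat X}},p_{\underline X^*})\right]}{n_1n_2n_3}\ \le\ 3\min_{\underline X=[A,B,C]\in\mathcal X}\left\{\frac{D(p_{\underline X^*}\|p_{\underline X})}{n_1n_2n_3}+\left(\lambda+\frac{8Q_D(\beta+2)\log n_{\max}}{3}\right)\frac{(n_1+n_2)F+\|C\|_0}{m}\right\}+\frac{8Q_D\log m}{m}.$$ -/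

import Mathlib

open MeasureTheory
open scoped ENNReal NNReal

noncomputable section

namespace SparseCP

/-! ### Probability densities, KL divergence and Hellinger affinity -/

section Densities

variable {Ω : Type*} [MeasurableSpace Ω]

/-- `f` is a probability density with respect to the reference measure `μ`. -/
structure IsProbDensity (μ : Measure Ω) (f : Ω → ℝ) : Prop where
  measurable : Measurable f
  nonneg : ∀ ω, 0 ≤ f ω
  lintegral_eq_one : ∫⁻ ω, ENNReal.ofReal (f ω) ∂μ = 1

/-- The law with density `f` with respect to `μ`. -/
def densityLaw (μ : Measure Ω) (f : Ω → ℝ) : Measure Ω :=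
  μ.withDensity (fun ω => ENNReal.ofReal (f ω))

/-- Kullback-Leibler divergence `D(f ‖ g) = 𝔼_f [log (f / g)]` of two probability densities
(infinite if the law of `f` is not absolutely continuous with respect to that of `g`). -/
def klDensity (μ : Measure Ω) (f g : Ω → ℝ) : ℝ≥0∞ :=
  InformationTheory.klDiv (densityLaw μ f) (densityLaw μ g)

/-- Hellinger affinity `A(f, g) = 𝔼_f [√(g / f)]` of two probability densities. -/
def hellingerAffinity (μ : Measure Ω) (f g : Ω → ℝ) : ℝ :=
  ∫ ω, √(g ω / f ω) ∂(densityLaw μ f)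

end Densities

/-! ### Tensors and sparse CP factors -/

/-- Index set of the entries of an `n₁ × n₂ × n₃` tensor. -/
abbrev Idx (n₁ n₂ n₃ : ℕ) : Type := Fin n₁ × Fin n₂ × Fin n₃

/-- Triples `(A, B, C)` of factor matrices with `F` columns each. -/
@[ext]
structure CPFactors (n₁ n₂ n₃ F : ℕ) where
  A : Matrix (Fin n₁) (Fin F) ℝ
  B : Matrix (Fin n₂) (Fin F) ℝ
  C : Matrix (Fin n₃) (Fin F) ℝ

variable {n₁ n₂ n₃ F : ℕ}

/-- The tensor `[A, B, C] = ∑_f a_f ∘ b_f ∘ c_f`. -/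
def CPFactors.tensor (t : CPFactors n₁ n₂ n₃ F) : Idx n₁ n₂ n₃ → ℝ :=
  fun e => ∑ f, t.A e.1 f * t.B e.2.1 f * t.C e.2.2 f

/-- `‖C‖₀`, the number of nonzero entries of a matrix. -/
def l0norm {k l : ℕ} (C : Matrix (Fin k) (Fin l) ℝ) : ℕ :=
  (Finset.univ.filter (fun e : Fin k × Fin l => C e.1 e.2 ≠ 0)).card

/-- `n_max = max {n₁, n₂, n₃, F}`. -/
def nMax (n₁ n₂ n₃ F : ℕ) : ℕ := max (max n₁ n₂) (max n₃ F)

/-- `L_lev = 2 ^ ⌈log₂ (n_max ^ β)⌉` for `n_max = n`. -/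
def levelCount (n : ℕ) (β : ℝ) : ℕ := 2 ^ ⌈Real.logb 2 ((n : ℝ) ^ β)⌉₊

/-- `L` uniformly spaced levels from `-M` to `M`. -/
def levels (L : ℕ) (M : ℝ) : Set ℝ :=
  {x | ∃ i : Fin L, x = -M + 2 * M * (i : ℝ) / ((L : ℝ) - 1)}

/-- The full discretized candidate class: the entries of `A` and `B` are levels, the entries of `C`
are levels or zero, and the tensor `[A, B, C]` is bounded by `Xmax`. -/
def candidates (n₁ n₂ n₃ F : ℕ) (β Amax Bmax Cmax Xmax : ℝ) : Set (CPFactors n₁ n₂ n₃ F) :=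
  {t | (∀ i f, t.A i f ∈ levels (levelCount (nMax n₁ n₂ n₃ F) β) Amax) ∧
       (∀ i f, t.B i f ∈ levels (levelCount (nMax n₁ n₂ n₃ F) β) Bmax) ∧
       (∀ i f, t.C i f = 0 ∨ t.C i f ∈ levels (levelCount (nMax n₁ n₂ n₃ F) β) Cmax) ∧
       ∀ e, |t.tensor e| ≤ Xmax}

/-! ### Observations and the penalized maximum likelihood estimate -/

variable {𝓨 : Type*}

/-- The density `y ↦ ∏ i, p_{x i} (y i)` of a finite family of independent observations with
parameters `x i`. -/
def prodDensity {ι : Type*} [Fintype ι] (p : ℝ → 𝓨 → ℝ) (x : ι → ℝ) (y : ι → 𝓨) : ℝ :=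
  ∏ i, p (x i) (y i)

/-- An observation: a set `S` of sampled entries together with the values `Y_S`. -/
abbrev Obs (n₁ n₂ n₃ : ℕ) (𝓨 : Type*) : Type _ :=
  Σ S : Finset (Idx n₁ n₂ n₃), (S → 𝓨)

/-- The likelihood `p_{X_S}(Y_S)`. -/
def likelihood (p : ℝ → 𝓨 → ℝ) (X : Idx n₁ n₂ n₃ → ℝ) (o : Obs n₁ n₂ n₃ 𝓨) : ℝ :=
  prodDensity p (fun e : o.1 => X e) o.2

/-- The objective `-log p_{X_S}(Y_S) + lam * ‖C‖₀` at `X = [A, B, C]`, equal to `+∞` where the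
likelihood vanishes. -/
def penalizedNegLogLik (p : ℝ → 𝓨 → ℝ) (lam : ℝ) (o : Obs n₁ n₂ n₃ 𝓨)
    (t : CPFactors n₁ n₂ n₃ F) : EReal :=
  -ENNReal.log (ENNReal.ofReal (likelihood p t.tensor o)) + ((lam * (l0norm t.C : ℝ) : ℝ) : EReal)

variable [MeasurableSpace 𝓨]

/-- Probability of the sampling set `S` when every entry is sampled independently with
probability `γ`. -/
def bernoulliWeight (γ : ℝ) (S : Finset (Idx n₁ n₂ n₃)) : ℝ :=
  ∏ e, if e ∈ S then γ else 1 - γ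

/-- The joint law of `(S, Y_S)`: `S` follows the independent Bernoulli model with rate `γ` and,
given `S`, the observations `Y_S` have joint density `p_{X_S}` with respect to the product of copies
of `ν`. -/
def obsLaw (ν : Measure 𝓨) [SigmaFinite ν] (p : ℝ → 𝓨 → ℝ) (X : Idx n₁ n₂ n₃ → ℝ) (γ : ℝ) :
    Measure (Obs n₁ n₂ n₃ 𝓨) :=
  ∑ S : Finset (Idx n₁ n₂ n₃), ENNReal.ofReal (bernoulliWeight γ S) •
    (densityLaw (Measure.pi fun _ : S => ν)
      (prodDensity p (fun e : S => X e))).map (fun y => (⟨S, y⟩ : Obs n₁ n₂ n₃ 𝓨))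

/-- `est` is a (measurable) `ℓ₀`-penalized maximum likelihood estimator over the class `𝒳`: it
depends on `(S, Y_S)` only and selects, for each observation, a minimizer of the objective. -/
structure IsPenalizedMLE (p : ℝ → 𝓨 → ℝ) (lam : ℝ) (𝒳 : Finset (CPFactors n₁ n₂ n₃ F))
    (est : Obs n₁ n₂ n₃ 𝓨 → CPFactors n₁ n₂ n₃ F) : Prop where
  measurableSet_fiber : ∀ t, MeasurableSet (est ⁻¹' {t})
  mem : ∀ o, est o ∈ 𝒳
  minimizes : ∀ o, ∀ t ∈ 𝒳,
    penalizedNegLogLik p lam o (est o) ≤ penalizedNegLogLik p lam o t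

/-- `D(p_X ‖ p_{X'})` for the joint laws of observations of all the entries. -/
def klTensor (ν : Measure 𝓨) [SigmaFinite ν] (p : ℝ → 𝓨 → ℝ) (X X' : Idx n₁ n₂ n₃ → ℝ) : ℝ≥0∞ :=
  klDensity (Measure.pi fun _ : Idx n₁ n₂ n₃ => ν) (prodDensity p X) (prodDensity p X')

/-- `A(p_X, p_{X'})` for the joint laws of observations of all the entries. -/
def affinityTensor (ν : Measure 𝓨) [SigmaFinite ν] (p : ℝ → 𝓨 → ℝ)
    (X X' : Idx n₁ n₂ n₃ → ℝ) : ℝ :=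
  hellingerAffinity (Measure.pi fun _ : Idx n₁ n₂ n₃ => ν) (prodDensity p X) (prodDensity p X')

end SparseCP

end

/-! The argument is an exponential-moment (Li–Barron type) bound for penalized likelihood, with a
second exponential moment handling the random sampling. Write `a t e` for the single-entry loss `-2
log A` of candidate `t` at entry `e`, and `pen` for a complexity with `∑ exp (-pen t) ≤ 1` over the
candidates (`sum_exp_neg_penalty_le_one`). Two quantities are attached to each candidate. Half the
negative log-likelihood ratio, plus half the loss on the sampled entries, has exponential moment
exactly one, because affinities multiply over independent entries
(`integrable_and_integral_exp_compensated`). A small multiple of `γ/3` times the full loss, minus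
the loss on the sampled entries, has exponential moment at most one (`sum_weight_mul_exp_le_one`);
this uses `0 ≤ a ≤ D ≤ QD`. After `pen` is subtracted from each, `exp x ≥ 1 + x` and the Kraft sum
show that both have nonpositive mean at the data-driven choice (`integral_select_nonpos`).

Adding the two cancels the loss on the sampled entries. What remains bounds `γ/3` times the expected
full loss by the expected penalized log-likelihood ratio at the estimator, hence by its value at any
fixed candidate, whose mean is `γ D` plus the penalty (`oracle_inequality`). Dividing by `γ/3`
produces the factor 3. This gives a bound with `λ` alone in front of the complexity and no `log m /
m` term; the remaining terms of the theorem are nonnegative slack. -/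

noncomputable section

namespace SparseCP

/-! ### Divergence and affinity of two densities. -/

section Densities

variable {Ω : Type*} [MeasurableSpace Ω] {μ : Measure Ω} {f g : Ω → ℝ}

lemma IsProbDensity.isProbabilityMeasure (hf : IsProbDensity μ f) :
    IsProbabilityMeasure (densityLaw μ f) :=
  ⟨by simp [densityLaw, hf.lintegral_eq_one]⟩

lemma IsProbDensity.measurable_ofReal (hf : IsProbDensity μ f) :
    Measurable fun ω => ENNReal.ofReal (f ω) := hf.measurable.ennreal_ofReal

lemma IsProbDensity.measurable_ofReal_div (hf : IsProbDensity μ f) (hg : IsProbDensity μ g) :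
    Measurable fun ω => ENNReal.ofReal (f ω / g ω) :=
  (hf.measurable.div hg.measurable).ennreal_ofReal

lemma IsProbDensity.ae_pos (hf : IsProbDensity μ f) : ∀ᵐ ω ∂(densityLaw μ f), 0 < f ω := by
  rw [densityLaw, ae_withDensity_iff hf.measurable_ofReal]
  filter_upwards with ω h
  simpa using h

/-- Where `f` vanishes both sides carry no mass, and elsewhere `g * (f / g) = f`. This identifies
the Radon–Nikodym derivative with the pointwise ratio, so the abstract divergence becomes an
integral of `log (f / g)`. -/
lemma densityLaw_eq_withDensity_div (hf : IsProbDensity μ f) (hg : IsProbDensity μ g)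
    (hpos : ∀ᵐ ω ∂(densityLaw μ f), 0 < g ω) :
    densityLaw μ f = (densityLaw μ g).withDensity (fun ω => ENNReal.ofReal (f ω / g ω)) := by
  rw [densityLaw, ae_withDensity_iff hf.measurable_ofReal] at hpos
  rw [densityLaw, densityLaw, ← withDensity_mul _ hg.measurable_ofReal
    (hf.measurable_ofReal_div hg)]
  refine withDensity_congr_ae ?_
  filter_upwards [hpos] with ω h
  simp only [Pi.mul_apply]
  rw [← ENNReal.ofReal_mul (hg.nonneg ω)]
  rcases (hf.nonneg ω).eq_or_lt with h0 | h0
  · simp [← h0]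
  · have := h (by simpa using h0)
    congr 1
    field_simp

lemma absolutelyContinuous_iff_ae_pos (hf : IsProbDensity μ f) (hg : IsProbDensity μ g) :
    densityLaw μ f ≪ densityLaw μ g ↔ ∀ᵐ ω ∂(densityLaw μ f), 0 < g ω := by
  refine ⟨fun h => h.ae_le hg.ae_pos, fun h => ?_⟩
  rw [densityLaw_eq_withDensity_div hf hg h]
  exact withDensity_absolutelyContinuous _ _

lemma llr_densityLaw (hf : IsProbDensity μ f) (hg : IsProbDensity μ g)
    (hpos : ∀ᵐ ω ∂(densityLaw μ f), 0 < g ω) :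
    llr (densityLaw μ f) (densityLaw μ g) =ᵐ[densityLaw μ f] fun ω => Real.log (f ω / g ω) := by
  have := hg.isProbabilityMeasure
  have h1 := Measure.rnDeriv_withDensity (densityLaw μ g)
    (hf.measurable_ofReal_div hg)
  rw [← densityLaw_eq_withDensity_div hf hg hpos] at h1
  filter_upwards [((absolutelyContinuous_iff_ae_pos hf hg).2 hpos).ae_le h1] with ω h
  rw [llr, h, ENNReal.toReal_ofReal (div_nonneg (hf.nonneg ω) (hg.nonneg ω))]

lemma klDensity_ne_top_iff (hf : IsProbDensity μ f) (hg : IsProbDensity μ g) :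
    klDensity μ f g ≠ ∞ ↔ (∀ᵐ ω ∂(densityLaw μ f), 0 < g ω) ∧
      Integrable (fun ω => Real.log (f ω / g ω)) (densityLaw μ f) := by
  rw [klDensity, InformationTheory.klDiv_ne_top_iff, absolutelyContinuous_iff_ae_pos hf hg]
  exact and_congr_right fun h => integrable_congr (llr_densityLaw hf hg h)

lemma toReal_klDensity (hf : IsProbDensity μ f) (hg : IsProbDensity μ g)
    (hpos : ∀ᵐ ω ∂(densityLaw μ f), 0 < g ω) :
    (klDensity μ f g).toReal = ∫ ω, Real.log (f ω / g ω) ∂(densityLaw μ f) := by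
  have := hf.isProbabilityMeasure
  have := hg.isProbabilityMeasure
  -- The general divergence carries a correction by the difference of total masses, which is zero
  -- for two probability laws.
  rw [klDensity, InformationTheory.toReal_klDiv_of_measure_eq
    ((absolutelyContinuous_iff_ae_pos hf hg).2 hpos) (by simp)]
  exact integral_congr_ae (llr_densityLaw hf hg hpos)

/-- The symmetric form is what allows the two arguments to be exchanged: the loss is stated with the
candidate first, while all expectations are taken under the true law. -/
lemma hellingerAffinity_eq_integral (hf : IsProbDensity μ f) :
    hellingerAffinity μ f g = ∫ ω, √(f ω) * √(g ω) ∂μ := by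
  rw [hellingerAffinity, densityLaw,
    integral_withDensity_eq_integral_toReal_smul hf.measurable_ofReal (by simp)]
  refine integral_congr_ae (ae_of_all _ fun ω => ?_)
  simp only [smul_eq_mul]
  rw [ENNReal.toReal_ofReal (hf.nonneg ω), Real.sqrt_div' _ (hf.nonneg ω)]
  rcases (hf.nonneg ω).eq_or_lt with h0 | h0
  · simp [← h0]
  · have h1 := Real.sqrt_pos.2 h0
    nth_rw 1 [← Real.mul_self_sqrt h0.le]
    field_simp

lemma hellingerAffinity_comm (hf : IsProbDensity μ f) (hg : IsProbDensity μ g) :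
    hellingerAffinity μ f g = hellingerAffinity μ g f := by
  simp_rw [hellingerAffinity_eq_integral hf, hellingerAffinity_eq_integral hg, mul_comm]

/-- Only an inequality: the mass of `g` on `{f = 0}` is lost, since there `g / f` is `0` by
convention and the law of `f` has no mass. -/
lemma lintegral_ratio_le_one (hf : IsProbDensity μ f) (hg : IsProbDensity μ g) :
    ∫⁻ ω, ENNReal.ofReal (g ω / f ω) ∂(densityLaw μ f) ≤ 1 := by
  rw [densityLaw, lintegral_withDensity_eq_lintegral_mul _ hf.measurable_ofReal
    (hg.measurable_ofReal_div hf), ← hg.lintegral_eq_one]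
  refine lintegral_mono fun ω => ?_
  simp only [Pi.mul_apply]
  rw [← ENNReal.ofReal_mul (hf.nonneg ω)]
  refine ENNReal.ofReal_le_ofReal ?_
  rcases (hf.nonneg ω).eq_or_lt with h0 | h0
  · simp [← h0, hg.nonneg ω]
  · exact (mul_div_cancel₀ _ h0.ne').le

lemma integrable_ratio (hf : IsProbDensity μ f) (hg : IsProbDensity μ g) :
    Integrable (fun ω => g ω / f ω) (densityLaw μ f) := by
  refine ⟨(hg.measurable.div hf.measurable).aestronglyMeasurable, ?_⟩
  rw [hasFiniteIntegral_iff_ofReal (ae_of_all _ fun ω => div_nonneg (hg.nonneg ω) (hf.nonneg ω))]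
  exact (lintegral_ratio_le_one hf hg).trans_lt ENNReal.one_lt_top

lemma integral_ratio_le_one (hf : IsProbDensity μ f) (hg : IsProbDensity μ g) :
    ∫ ω, g ω / f ω ∂(densityLaw μ f) ≤ 1 := by
  rw [integral_eq_lintegral_of_nonneg_ae
    (ae_of_all _ fun ω => div_nonneg (hg.nonneg ω) (hf.nonneg ω))
    (integrable_ratio hf hg).aestronglyMeasurable]
  exact ENNReal.toReal_le_of_le_ofReal zero_le_one (by simpa using lintegral_ratio_le_one hf hg)

lemma sqrt_le_half_add {x : ℝ} (hx : 0 ≤ x) : √x ≤ (1 + x) / 2 := by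
  nlinarith [sq_nonneg (√x - 1), Real.sq_sqrt hx]

lemma integrable_sqrt_ratio (hf : IsProbDensity μ f) (hg : IsProbDensity μ g) :
    Integrable (fun ω => √(g ω / f ω)) (densityLaw μ f) := by
  have := hf.isProbabilityMeasure
  refine (((integrable_const 1).add (integrable_ratio hf hg)).div_const 2).mono'
    (hg.measurable.div hf.measurable).sqrt.aestronglyMeasurable (ae_of_all _ fun ω => ?_)
  rw [Real.norm_of_nonneg (Real.sqrt_nonneg _)]
  exact sqrt_le_half_add (div_nonneg (hg.nonneg ω) (hf.nonneg ω))

lemma hellingerAffinity_le_one (hf : IsProbDensity μ f) (hg : IsProbDensity μ g) :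
    hellingerAffinity μ f g ≤ 1 := by
  have := hf.isProbabilityMeasure
  have hint := ((integrable_const (μ := densityLaw μ f) (1 : ℝ)).add
    (integrable_ratio hf hg)).div_const 2
  refine (integral_mono (integrable_sqrt_ratio hf hg) hint fun ω =>
    sqrt_le_half_add (div_nonneg (hg.nonneg ω) (hf.nonneg ω))).trans ?_
  simp only [Pi.add_apply]
  rw [integral_div, integral_add (integrable_const _) (integrable_ratio hf hg)]
  have := integral_ratio_le_one hf hg
  simp
  linarith

lemma exp_half_log {x : ℝ} (hx : 0 < x) : Real.exp (Real.log x / 2) = √x := by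
  rw [Real.sqrt_eq_rpow, Real.rpow_def_of_pos hx]
  ring_nf

/-- Jensen's inequality for `exp` applied to `-log (f / g) / 2`, proved by integrating the tangent
line of `exp` at the mean `-d / 2`. It makes the affinity positive and bounds the loss by the
divergence. -/
lemma exp_neg_half_kl_le_hellingerAffinity (hf : IsProbDensity μ f) (hg : IsProbDensity μ g)
    (h : klDensity μ f g ≠ ∞) :
    Real.exp (-(klDensity μ f g).toReal / 2) ≤ hellingerAffinity μ f g := by
  have := hf.isProbabilityMeasure
  obtain ⟨hpos, hint⟩ := (klDensity_ne_top_iff hf hg).1 h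
  rw [toReal_klDensity hf hg hpos]
  set d := ∫ ω, Real.log (f ω / g ω) ∂(densityLaw μ f) with hd
  have hint' := (((hint.neg.div_const 2).add (integrable_const (d / 2))).add
    (integrable_const 1)).const_mul (Real.exp (-d / 2))
  have key := integral_mono_ae hint' (integrable_sqrt_ratio hf hg) (by
    filter_upwards [hpos, hf.ae_pos] with ω h1 h2
    simp only [Pi.add_apply, Pi.neg_apply]
    rw [← exp_half_log (div_pos h1 h2), ← inv_div (f ω), Real.log_inv]
    have := Real.add_one_le_exp (-Real.log (f ω / g ω) / 2 + d / 2)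
    refine (mul_le_mul_of_nonneg_left this (Real.exp_pos _).le).trans_eq ?_
    rw [← Real.exp_add]
    ring_nf)
  refine le_trans (le_of_eq ?_) key
  simp only [Pi.add_apply, Pi.neg_apply]
  rw [integral_const_mul, integral_add, integral_add, integral_div, integral_neg, ← hd]
  · simp
    ring
  · exact hint.neg.div_const 2
  · exact integrable_const _
  · exact (hint.neg.div_const 2).add (integrable_const _)
  · exact integrable_const _

end Densities

/-! ### Tensorization over independent entries. -/

section Products

lemma log_prodDensity_div {𝓨 ι : Type*} [Fintype ι] {p : ℝ → 𝓨 → ℝ} {x x' : ι → ℝ} {y : ι → 𝓨} (h : ∀ i, 0 < p (x i) (y i))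
    (h' : ∀ i, 0 < p (x' i) (y i)) :
    Real.log (prodDensity p x y / prodDensity p x' y) =
      ∑ i, Real.log (p (x i) (y i) / p (x' i) (y i)) := by
  rw [prodDensity, prodDensity, ← Finset.prod_div_distrib,
    Real.log_prod fun i _ => (div_pos (h i) (h' i)).ne']

variable {𝓨 : Type*} [MeasurableSpace 𝓨] {ν : Measure 𝓨} {p : ℝ → 𝓨 → ℝ}
  {ι : Type*} [Fintype ι]

lemma measurable_prodDensity (hp : ∀ x, IsProbDensity ν (p x)) (x : ι → ℝ) :
    Measurable (prodDensity p x) :=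
  Finset.measurable_prod _ fun i _ => (hp (x i)).measurable.comp (measurable_pi_apply i)

lemma prodDensity_nonneg (hp : ∀ x, IsProbDensity ν (p x)) (x : ι → ℝ) (y : ι → 𝓨) :
    0 ≤ prodDensity p x y :=
  Finset.prod_nonneg fun i _ => (hp (x i)).nonneg _

lemma IsProbDensity.integrable {Ω : Type*} [MeasurableSpace Ω] {μ : Measure Ω} {f : Ω → ℝ}
    (hf : IsProbDensity μ f) : Integrable f μ := by
  refine ⟨hf.measurable.aestronglyMeasurable, ?_⟩
  rw [hasFiniteIntegral_iff_ofReal (ae_of_all _ hf.nonneg), hf.lintegral_eq_one]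
  exact ENNReal.one_lt_top

lemma ae_pi_of_ae {P : ι → Measure 𝓨} [∀ i, IsProbabilityMeasure (P i)] {q : ι → 𝓨 → Prop}
    (h : ∀ i, ∀ᵐ y ∂(P i), q i y) : ∀ᵐ y ∂(Measure.pi P), ∀ i, q i (y i) :=
  ae_all_iff.2 fun i => (measurePreserving_eval P i).quasiMeasurePreserving.ae (h i)

lemma ae_prodDensity_pos (hp : ∀ x, IsProbDensity ν (p x)) {x x' : ι → ℝ}
    (h : ∀ i, klDensity ν (p (x i)) (p (x' i)) ≠ ∞) :
    ∀ᵐ y ∂(Measure.pi fun i => densityLaw ν (p (x i))),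
      (∀ i, 0 < p (x i) (y i)) ∧ ∀ i, 0 < p (x' i) (y i) := by
  have := fun i => (hp (x i)).isProbabilityMeasure
  exact (ae_pi_of_ae fun i => (hp (x i)).ae_pos).and
    (ae_pi_of_ae (q := fun i y => 0 < p (x' i) y) fun i =>
      ((klDensity_ne_top_iff (hp _) (hp _)).1 (h i)).1)

lemma integrable_log_ratio_eval (hp : ∀ x, IsProbDensity ν (p x)) {x x' : ι → ℝ}
    (h : ∀ i, klDensity ν (p (x i)) (p (x' i)) ≠ ∞) (i : ι) :
    Integrable (fun y => Real.log (p (x i) (y i) / p (x' i) (y i)))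
      (Measure.pi fun i => densityLaw ν (p (x i))) := by
  have := fun i => (hp (x i)).isProbabilityMeasure
  exact (measurePreserving_eval (fun i => densityLaw ν (p (x i))) i).integrable_comp_of_integrable
    ((klDensity_ne_top_iff (hp _) (hp _)).1 (h i)).2

lemma integral_sum_log_ratio (hp : ∀ x, IsProbDensity ν (p x)) {x x' : ι → ℝ}
    (h : ∀ i, klDensity ν (p (x i)) (p (x' i)) ≠ ∞) :
    ∫ y, ∑ i, Real.log (p (x i) (y i) / p (x' i) (y i))
      ∂(Measure.pi fun i => densityLaw ν (p (x i))) =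
      ∑ i, (klDensity ν (p (x i)) (p (x' i))).toReal := by
  have := fun i => (hp (x i)).isProbabilityMeasure
  rw [integral_finsetSum _ fun i _ => integrable_log_ratio_eval hp h i]
  refine Finset.sum_congr rfl fun i _ => ?_
  obtain ⟨h1, h2⟩ := (klDensity_ne_top_iff (hp _) (hp _)).1 (h i)
  rw [toReal_klDensity (hp _) (hp _) h1]
  have mp := measurePreserving_eval (fun i => densityLaw ν (p (x i))) i
  have e := integral_map mp.measurable.aemeasurable (mp.map_eq.symm ▸ h2.aestronglyMeasurable)
  rw [mp.map_eq] at e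
  exact e.symm

variable [SigmaFinite ν]

/-- It suffices to compare on boxes, where the indicator times the product density is a product of
one-variable functions and Fubini applies. -/
lemma densityLaw_prodDensity (hp : ∀ x, IsProbDensity ν (p x)) (x : ι → ℝ) :
    densityLaw (Measure.pi fun _ : ι => ν) (prodDensity p x) =
      Measure.pi fun i => densityLaw ν (p (x i)) := by
  have := fun i => (hp (x i)).isProbabilityMeasure
  refine (Measure.pi_eq fun s hs => ?_).symm
  have hint : ∀ i, Integrable ((s i).indicator (p (x i))) ν := fun i =>
    (hp (x i)).integrable.indicator (hs i)
  have hnn : ∀ i y, 0 ≤ (s i).indicator (p (x i)) y := fun i y =>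
    Set.indicator_nonneg (fun y _ => (hp (x i)).nonneg y) y
  have key := integral_fintype_prod_eq_prod (μ := fun _ : ι => ν)
    (fun i => (s i).indicator (p (x i)))
  have hprod : ∀ y : ι → 𝓨, ∏ i, (s i).indicator (p (x i)) (y i) =
      (Set.univ.pi s).indicator (prodDensity p x) y := by
    intro y
    by_cases hy : y ∈ Set.univ.pi s
    · rw [Set.indicator_of_mem hy]
      exact Finset.prod_congr rfl fun i _ => Set.indicator_of_mem (hy i trivial) _
    · rw [Set.indicator_of_notMem hy]
      simp only [Set.mem_pi, Set.mem_univ, true_implies, not_forall] at hy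
      obtain ⟨i, hi⟩ := hy
      exact Finset.prod_eq_zero (Finset.mem_univ i) (Set.indicator_of_notMem hi _)
  have e1 : ∀ i, densityLaw ν (p (x i)) (s i) =
      ENNReal.ofReal (∫ y, (s i).indicator (p (x i)) y ∂ν) := by
    intro i
    rw [ofReal_integral_eq_lintegral_ofReal (hint i) (ae_of_all _ (hnn i)), densityLaw,
      withDensity_apply _ (hs i), ← lintegral_indicator (hs i)]
    refine lintegral_congr fun y => ?_
    by_cases hy : y ∈ s i <;> simp [hy]
  simp_rw [e1]
  rw [← ENNReal.ofReal_prod_of_nonneg fun i _ => integral_nonneg (hnn i), ← key,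
    ofReal_integral_eq_lintegral_ofReal (Integrable.fintype_prod hint)
      (ae_of_all _ fun y => Finset.prod_nonneg fun i _ => hnn i _), densityLaw,
    withDensity_apply _ (MeasurableSet.univ_pi hs), ← lintegral_indicator (MeasurableSet.univ_pi hs)]
  refine lintegral_congr fun y => ?_
  rw [hprod]
  by_cases hy : y ∈ Set.univ.pi s
  · rw [Set.indicator_of_mem hy, Set.indicator_of_mem hy]
  · rw [Set.indicator_of_notMem hy, Set.indicator_of_notMem hy, ENNReal.ofReal_zero]

lemma isProbDensity_prodDensity (hp : ∀ x, IsProbDensity ν (p x)) (x : ι → ℝ) :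
    IsProbDensity (Measure.pi fun _ : ι => ν) (prodDensity p x) := by
  have := fun i => (hp (x i)).isProbabilityMeasure
  refine ⟨measurable_prodDensity hp x, prodDensity_nonneg hp x, ?_⟩
  rw [← setLIntegral_univ, ← withDensity_apply _ MeasurableSet.univ]
  change densityLaw _ (prodDensity p x) _ = 1
  rw [densityLaw_prodDensity hp x]
  exact measure_univ

lemma klDensity_prodDensity_ne_top (hp : ∀ x, IsProbDensity ν (p x)) {x x' : ι → ℝ}
    (h : ∀ i, klDensity ν (p (x i)) (p (x' i)) ≠ ∞) :
    klDensity (Measure.pi fun _ : ι => ν) (prodDensity p x) (prodDensity p x') ≠ ∞ := by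
  rw [klDensity_ne_top_iff (isProbDensity_prodDensity hp x) (isProbDensity_prodDensity hp x'),
    densityLaw_prodDensity hp]
  refine ⟨?_, (integrable_finsetSum Finset.univ fun i _ =>
    integrable_log_ratio_eval hp h i).congr ?_⟩
  · filter_upwards [ae_prodDensity_pos hp h] with y hy
    exact Finset.prod_pos fun i _ => hy.2 i
  · filter_upwards [ae_prodDensity_pos hp h] with y hy
    exact (log_prodDensity_div hy.1 hy.2).symm

lemma toReal_klDensity_prodDensity (hp : ∀ x, IsProbDensity ν (p x)) {x x' : ι → ℝ}
    (h : ∀ i, klDensity ν (p (x i)) (p (x' i)) ≠ ∞) :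
    (klDensity (Measure.pi fun _ : ι => ν) (prodDensity p x) (prodDensity p x')).toReal =
      ∑ i, (klDensity ν (p (x i)) (p (x' i))).toReal := by
  have h1 := isProbDensity_prodDensity hp x
  have h2 := isProbDensity_prodDensity hp x'
  rw [toReal_klDensity h1 h2
    ((klDensity_ne_top_iff h1 h2).1 (klDensity_prodDensity_ne_top hp h)).1,
    densityLaw_prodDensity hp, ← integral_sum_log_ratio hp h]
  refine integral_congr_ae ?_
  filter_upwards [ae_prodDensity_pos hp h] with y hy
  exact log_prodDensity_div hy.1 hy.2

lemma hellingerAffinity_prodDensity (hp : ∀ x, IsProbDensity ν (p x)) (x x' : ι → ℝ) :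
    hellingerAffinity (Measure.pi fun _ : ι => ν) (prodDensity p x) (prodDensity p x') =
      ∏ i, hellingerAffinity ν (p (x i)) (p (x' i)) := by
  have := fun i => (hp (x i)).isProbabilityMeasure
  simp only [hellingerAffinity]
  rw [densityLaw_prodDensity hp, ← integral_fintype_prod_eq_prod
    (μ := fun i => densityLaw ν (p (x i))) (fun i y => √(p (x' i) y / p (x i) y))]
  refine integral_congr_ae (ae_of_all _ fun y => ?_)
  simp only [prodDensity]
  rw [← Finset.prod_div_distrib, Real.sqrt_prod]
  exact fun i _ => div_nonneg ((hp _).nonneg _) ((hp _).nonneg _)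

end Products

/-! ### Bernoulli sampling of the entries. -/

section Sampling

variable {ι : Type*} [Fintype ι] [DecidableEq ι]

lemma sum_finset_prod_ite (f g : ι → ℝ) :
    ∑ S : Finset ι, ∏ e, (if e ∈ S then f e else g e) = ∏ e, (f e + g e) := by
  rw [Finset.prod_add, Finset.powerset_univ]
  refine Finset.sum_congr rfl fun S _ => ?_
  rw [Finset.prod_ite]
  congr 2
  · ext; simp
  · ext; simp

lemma sum_weight_eq_one (γ : ℝ) :
    ∑ S : Finset ι, ∏ e, (if e ∈ S then γ else 1 - γ) = 1 := by
  rw [sum_finset_prod_ite (fun _ => γ) (fun _ => 1 - γ)]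
  simp

/-- Requiring `e ∈ S` amounts to setting the non-inclusion weight of `e` to zero, after which the
sum over `S` factors over the entries. -/
lemma sum_weight_mem (γ : ℝ) (e : ι) :
    ∑ S : Finset ι, (∏ i, if i ∈ S then γ else 1 - γ) * (if e ∈ S then 1 else 0) = γ := by
  have h : ∀ S : Finset ι, (∏ i, if i ∈ S then γ else 1 - γ) * (if e ∈ S then (1 : ℝ) else 0) =
      ∏ i, if i ∈ S then γ else (if i = e then 0 else 1 - γ) := by
    intro S
    by_cases he : e ∈ S
    · rw [if_pos he, mul_one]
      refine Finset.prod_congr rfl fun i _ => ?_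
      by_cases hi : i ∈ S
      · simp [hi]
      · have : i ≠ e := fun h => hi (h ▸ he)
        simp [hi, this]
    · rw [if_neg he, mul_zero]
      exact (Finset.prod_eq_zero (Finset.mem_univ e) (by simp [he])).symm
  simp_rw [h]
  rw [sum_finset_prod_ite (fun _ => γ) (fun i => if i = e then 0 else 1 - γ),
    Finset.prod_eq_single e]
  · simp
  · intro i _ hi
    simp [hi]
  · simp

lemma sum_weight_mul_sum (γ : ℝ) (d : ι → ℝ) :
    ∑ S : Finset ι, (∏ i, if i ∈ S then γ else 1 - γ) * ∑ e ∈ S, d e = γ * ∑ e, d e := by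
  have h : ∀ S : Finset ι, (∏ i, if i ∈ S then γ else 1 - γ) * ∑ e ∈ S, d e =
      ∑ e, d e * ((∏ i, if i ∈ S then γ else 1 - γ) * (if e ∈ S then 1 else 0)) := by
    intro S
    rw [Finset.mul_sum, ← Finset.sum_filter_add_sum_filter_not Finset.univ (· ∈ S)]
    rw [Finset.sum_eq_zero (s := Finset.univ.filter fun e => ¬ e ∈ S), add_zero]
    · refine Finset.sum_congr (by ext; simp) fun e he => ?_
      simp only [Finset.mem_filter, Finset.mem_univ, true_and] at he
      simp only [he, if_true]
      ring
    · intro e he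
      simp only [Finset.mem_filter, Finset.mem_univ, true_and] at he
      simp [he]
  simp_rw [h]
  rw [Finset.sum_comm, Finset.mul_sum]
  refine Finset.sum_congr rfl fun e _ => ?_
  rw [← Finset.mul_sum, sum_weight_mem, mul_comm]

/-- From `exp (-x) ≤ 1 / (1 + x)` and `(1 - x / 3) (1 + x) ≥ 1`, the latter being valid up to `x =
2`. The slope `1/3` is the source of the constant 3 in the theorem. -/
lemma exp_neg_le_one_sub_third {x : ℝ} (h0 : 0 ≤ x) (h1 : x ≤ 3 / 4) :
    Real.exp (-x) ≤ 1 - x / 3 := by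
  have h2 : Real.exp x * Real.exp (-x) = 1 := by rw [← Real.exp_add]; simp
  have h3 := Real.add_one_le_exp x
  have h4 := Real.exp_pos (-x)
  nlinarith

/-- Exponential lower-tail bound for Bernoulli subsampling of a nonnegative sum. -/
lemma sum_weight_mul_exp_le_one {γ : ℝ} (hγ0 : 0 ≤ γ) (hγ1 : γ ≤ 1) {t : ℝ} {a : ι → ℝ}
    (h0 : ∀ e, 0 ≤ t * a e) (h1 : ∀ e, t * a e ≤ 3 / 4) :
    ∑ S : Finset ι, (∏ i, if i ∈ S then γ else 1 - γ) *
      Real.exp (t * (γ * (∑ e, a e) / 3 - ∑ e ∈ S, a e)) ≤ 1 := by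
  have h : ∀ S : Finset ι, (∏ i, if i ∈ S then γ else 1 - γ) *
      Real.exp (t * (γ * (∑ e, a e) / 3 - ∑ e ∈ S, a e)) =
      Real.exp (γ * (∑ e, t * a e) / 3) *
        ∏ e, if e ∈ S then γ * Real.exp (-(t * a e)) else 1 - γ := by
    intro S
    have h2 : Real.exp (-∑ e ∈ S, t * a e) = ∏ e, if e ∈ S then Real.exp (-(t * a e)) else 1 := by
      rw [← Finset.sum_neg_distrib, Real.exp_sum, Finset.prod_ite_mem, Finset.univ_inter]
    have h3 : t * (γ * (∑ e, a e) / 3 - ∑ e ∈ S, a e) =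
        γ * (∑ e, t * a e) / 3 + -∑ e ∈ S, t * a e := by
      rw [← Finset.mul_sum, ← Finset.mul_sum]
      ring
    rw [h3, Real.exp_add, h2, mul_left_comm, ← Finset.prod_mul_distrib]
    congr 1
    refine Finset.prod_congr rfl fun e _ => ?_
    split_ifs <;> simp
  simp_rw [h]
  rw [← Finset.mul_sum, sum_finset_prod_ite (fun e => γ * Real.exp (-(t * a e))) (fun _ => 1 - γ)]
  -- Entrywise, with `x = t * a e`: `γ exp (-x) + 1 - γ ≤ 1 - γ x / 3 ≤ exp (-γ x / 3)`.
  have h4 : ∏ e, (γ * Real.exp (-(t * a e)) + (1 - γ)) ≤ ∏ e, Real.exp (-(γ * (t * a e) / 3)) := by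
    refine Finset.prod_le_prod (fun e _ => by nlinarith [mul_nonneg hγ0 (Real.exp_pos (-(t * a e))).le]) fun e _ => ?_
    have h5 := exp_neg_le_one_sub_third (h0 e) (h1 e)
    have h6 := Real.add_one_le_exp (-(γ * (t * a e) / 3))
    nlinarith
  refine (mul_le_mul_of_nonneg_left h4 (Real.exp_pos _).le).trans_eq ?_
  rw [← Real.exp_sum, ← Real.exp_add, Finset.sum_neg_distrib, ← Finset.sum_div, ← Finset.mul_sum,
    ← Finset.mul_sum, ← Finset.mul_sum, add_neg_cancel, Real.exp_zero]

end Sampling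

/-! ### Data-driven selection from a finite class. -/

section Selection

variable {Ω T : Type*} {𝒳 : Finset T} {est : Ω → T}

lemma apply_select_eq_sum (hmem : ∀ o, est o ∈ 𝒳) (f : T → Ω → ℝ) (o : Ω) :
    f (est o) o = ∑ t ∈ 𝒳, (est ⁻¹' {t}).indicator (f t) o := by
  rw [Finset.sum_eq_single (est o)]
  · simp
  · intro t _ ht
    exact Set.indicator_of_notMem (fun h => ht (by simpa using h.symm)) _
  · exact fun h => absurd (hmem o) h

variable [MeasurableSpace Ω] {P : Measure Ω}

lemma integrable_select (hmeas : ∀ t, MeasurableSet (est ⁻¹' {t})) (hmem : ∀ o, est o ∈ 𝒳)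
    {f : T → Ω → ℝ} (hf : ∀ t ∈ 𝒳, Integrable (f t) P) :
    Integrable (fun o => f (est o) o) P := by
  simp_rw [apply_select_eq_sum hmem f]
  exact integrable_finsetSum _ fun t ht => (hf t ht).indicator (hmeas t)

/-- If the exponential moments of the candidates sum to at most one, a data-driven selection
has nonpositive mean. -/
lemma integral_select_nonpos [IsProbabilityMeasure P] (hmeas : ∀ t, MeasurableSet (est ⁻¹' {t}))
    (hmem : ∀ o, est o ∈ 𝒳) {Z : T → Ω → ℝ} (hZ : ∀ t ∈ 𝒳, Integrable (Z t) P)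
    (hexp : ∀ t ∈ 𝒳, Integrable (fun o => Real.exp (Z t o)) P) {c : T → ℝ}
    (hc : ∀ t ∈ 𝒳, ∫ o, Real.exp (Z t o) ∂P ≤ c t) (hsum : ∑ t ∈ 𝒳, c t ≤ 1) :
    ∫ o, Z (est o) o ∂P ≤ 0 := by
  have hint : Integrable (fun o => ∑ t ∈ 𝒳, Real.exp (Z t o)) P := integrable_finsetSum _ hexp
  have h1 : ∫ o, Z (est o) o ∂P ≤ ∫ o, (∑ t ∈ 𝒳, Real.exp (Z t o) - 1) ∂P := by
    refine integral_mono (integrable_select hmeas hmem hZ) (hint.sub (integrable_const 1))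
      fun o => ?_
    -- The selected exponential is one term of a nonnegative sum over all candidates, which removes
    -- the dependence of the index on the data.
    have h2 := Real.add_one_le_exp (Z (est o) o)
    have h3 := Finset.single_le_sum (f := fun t => Real.exp (Z t o))
      (fun t _ => (Real.exp_pos _).le) (hmem o)
    simp only at h3 ⊢
    linarith
  rw [integral_sub hint (integrable_const 1), integral_finsetSum _ hexp] at h1
  have h4 := Finset.sum_le_sum hc
  simp at h1
  linarith

end Selection

/-! ### The law of the sampled data and its log-likelihood ratios. -/

section Observations

variable {𝓨 : Type*} {n₁ n₂ n₃ : ℕ}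

lemma bernoulliWeight_nonneg {γ : ℝ} (hγ0 : 0 ≤ γ) (hγ1 : γ ≤ 1) (S : Finset (Idx n₁ n₂ n₃)) :
    0 ≤ bernoulliWeight γ S :=
  Finset.prod_nonneg fun e _ => by split_ifs <;> linarith

variable [MeasurableSpace 𝓨]

lemma measurable_sigma_mk {α : Type*} {β : α → Type*} [∀ a, MeasurableSpace (β a)] (a : α) :
    Measurable (Sigma.mk a : β a → Σ a, β a) :=
  Measurable.of_le_map (iInf_le _ a)

lemma measurable_sigma_of_fiber {α : Type*} {β : α → Type*} [∀ a, MeasurableSpace (β a)]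
    {γ : Type*} [MeasurableSpace γ] {f : (Σ a, β a) → γ} (hf : ∀ a, Measurable fun b => f ⟨a, b⟩) :
    Measurable f := fun s hs => by
  rw [Sigma.instMeasurableSpace, MeasurableSpace.measurableSet_iInf]
  exact fun a => hf a hs

lemma measurable_of_sample (f : Finset (Idx n₁ n₂ n₃) → ℝ) :
    Measurable fun o : Obs n₁ n₂ n₃ 𝓨 => f o.1 :=
  measurable_sigma_of_fiber fun S =>
    (measurable_const : Measurable fun _ : S → 𝓨 => f S)

variable {ν : Measure 𝓨} {p : ℝ → 𝓨 → ℝ} {X : Idx n₁ n₂ n₃ → ℝ} {γ : ℝ}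

lemma obsLaw_eq_sum [SigmaFinite ν] (hp : ∀ x, IsProbDensity ν (p x)) :
    obsLaw ν p X γ = ∑ S : Finset (Idx n₁ n₂ n₃), ENNReal.ofReal (bernoulliWeight γ S) •
      (Measure.pi fun e : S => densityLaw ν (p (X e))).map
        (fun y => (⟨S, y⟩ : Obs n₁ n₂ n₃ 𝓨)) := by
  unfold obsLaw
  refine Finset.sum_congr rfl fun S _ => ?_
  rw [densityLaw_prodDensity hp]

lemma isProbabilityMeasure_obsLaw [SigmaFinite ν] (hp : ∀ x, IsProbDensity ν (p x)) (hγ0 : 0 ≤ γ) (hγ1 : γ ≤ 1) :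
    IsProbabilityMeasure (obsLaw ν p X γ) := by
  have := fun x => (hp x).isProbabilityMeasure
  refine ⟨?_⟩
  rw [obsLaw_eq_sum hp, Measure.finsetSum_apply]
  have h : ∀ S : Finset (Idx n₁ n₂ n₃), (ENNReal.ofReal (bernoulliWeight γ S) •
      (Measure.pi fun e : S => densityLaw ν (p (X e))).map
        (fun y => (⟨S, y⟩ : Obs n₁ n₂ n₃ 𝓨))) Set.univ = ENNReal.ofReal (bernoulliWeight γ S) := by
    intro S
    have hmk : Measurable fun y : S → 𝓨 => (⟨S, y⟩ : Obs n₁ n₂ n₃ 𝓨) := measurable_sigma_mk S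
    rw [Measure.smul_apply, Measure.map_apply hmk MeasurableSet.univ]
    simp
  simp_rw [h]
  rw [← ENNReal.ofReal_sum_of_nonneg fun S _ => bernoulliWeight_nonneg hγ0 hγ1 S]
  simp only [bernoulliWeight]
  rw [sum_weight_eq_one, ENNReal.ofReal_one]

lemma integrable_obsLaw [SigmaFinite ν] (hp : ∀ x, IsProbDensity ν (p x)) {f : Obs n₁ n₂ n₃ 𝓨 → ℝ}
    (hf : Measurable f)
    (hint : ∀ S : Finset (Idx n₁ n₂ n₃),
      Integrable (fun y => f ⟨S, y⟩) (Measure.pi fun e : S => densityLaw ν (p (X e)))) :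
    Integrable f (obsLaw ν p X γ) := by
  rw [obsLaw_eq_sum hp, integrable_finsetSum_measure]
  intro S _
  refine Integrable.smul_measure ?_ ENNReal.ofReal_ne_top
  rw [integrable_map_measure hf.aestronglyMeasurable (measurable_sigma_mk S).aemeasurable]
  exact hint S

lemma integral_obsLaw [SigmaFinite ν] (hp : ∀ x, IsProbDensity ν (p x)) (hγ0 : 0 ≤ γ) (hγ1 : γ ≤ 1)
    {f : Obs n₁ n₂ n₃ 𝓨 → ℝ} (hf : Measurable f)
    (hint : ∀ S : Finset (Idx n₁ n₂ n₃),
      Integrable (fun y => f ⟨S, y⟩) (Measure.pi fun e : S => densityLaw ν (p (X e)))) :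
    ∫ o, f o ∂(obsLaw ν p X γ) = ∑ S : Finset (Idx n₁ n₂ n₃), bernoulliWeight γ S *
      ∫ y, f ⟨S, y⟩ ∂(Measure.pi fun e : S => densityLaw ν (p (X e))) := by
  rw [obsLaw_eq_sum hp, integral_finsetSum_measure]
  · refine Finset.sum_congr rfl fun S _ => ?_
    rw [integral_smul_measure, integral_map (measurable_sigma_mk S).aemeasurable
      hf.aestronglyMeasurable, ENNReal.toReal_ofReal (bernoulliWeight_nonneg hγ0 hγ1 S),
      smul_eq_mul]
  · intro S _
    refine Integrable.smul_measure ?_ ENNReal.ofReal_ne_top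
    rw [integrable_map_measure hf.aestronglyMeasurable (measurable_sigma_mk S).aemeasurable]
    exact hint S

lemma ae_obsLaw [SigmaFinite ν] (hp : ∀ x, IsProbDensity ν (p x)) {q : Obs n₁ n₂ n₃ 𝓨 → Prop}
    (hq : MeasurableSet {o | q o})
    (h : ∀ S : Finset (Idx n₁ n₂ n₃),
      ∀ᵐ y ∂(Measure.pi fun e : S => densityLaw ν (p (X e))), q ⟨S, y⟩) :
    ∀ᵐ o ∂(obsLaw ν p X γ), q o := by
  rw [obsLaw_eq_sum hp, ae_iff, Measure.finsetSum_apply]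
  refine Finset.sum_eq_zero fun S _ => ?_
  rw [Measure.smul_apply]
  refine smul_eq_zero_of_right _ ?_
  change Measure.map _ _ {o | q o}ᶜ = 0
  rw [Measure.map_apply (measurable_sigma_mk S) hq.compl]
  exact ae_iff.1 (h S)

lemma measurable_likelihood (hp : ∀ x, IsProbDensity ν (p x)) (X' : Idx n₁ n₂ n₃ → ℝ) :
    Measurable (likelihood p X' : Obs n₁ n₂ n₃ 𝓨 → ℝ) :=
  measurable_sigma_of_fiber fun S => measurable_prodDensity hp fun e : S => X' e

/-- Finite divergence forces absolute continuity, so values with zero candidate density are null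
under the true law. -/
lemma ae_likelihood_pos [SigmaFinite ν] (hp : ∀ x, IsProbDensity ν (p x)) {X' : Idx n₁ n₂ n₃ → ℝ}
    (h : ∀ e, klDensity ν (p (X e)) (p (X' e)) ≠ ∞) :
    ∀ᵐ o ∂(obsLaw ν p X γ), 0 < likelihood p X' o := by
  refine ae_obsLaw hp (measurableSet_lt measurable_const (measurable_likelihood hp X')) fun S => ?_
  filter_upwards [ae_prodDensity_pos hp (x := fun e : S => X e) (x' := fun e : S => X' e)
    fun e => h e] with y hy
  exact Finset.prod_pos fun e _ => hy.2 e

/-- The log-likelihood ratio of `X` against `X'` at an observation. -/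
def logLikRatio (p : ℝ → 𝓨 → ℝ) (X X' : Idx n₁ n₂ n₃ → ℝ) (o : Obs n₁ n₂ n₃ 𝓨) : ℝ :=
  Real.log (likelihood p X o / likelihood p X' o)

lemma measurable_logLikRatio (hp : ∀ x, IsProbDensity ν (p x)) (X' : Idx n₁ n₂ n₃ → ℝ) :
    Measurable (logLikRatio p X X' : Obs n₁ n₂ n₃ 𝓨 → ℝ) :=
  ((measurable_likelihood hp X).div (measurable_likelihood hp X')).log

lemma logLikRatio_fiber_ae_eq (hp : ∀ x, IsProbDensity ν (p x)) {X' : Idx n₁ n₂ n₃ → ℝ}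
    (h : ∀ e, klDensity ν (p (X e)) (p (X' e)) ≠ ∞) (S : Finset (Idx n₁ n₂ n₃)) :
    (fun y => logLikRatio p X X' ⟨S, y⟩) =ᵐ[Measure.pi fun e : S => densityLaw ν (p (X e))]
      fun y => ∑ e : S, Real.log (p (X e) (y e) / p (X' e) (y e)) := by
  filter_upwards [ae_prodDensity_pos hp (x := fun e : S => X e) (x' := fun e : S => X' e)
    fun e => h e] with y hy
  exact log_prodDensity_div hy.1 hy.2

lemma integrable_logLikRatio_fiber (hp : ∀ x, IsProbDensity ν (p x)) {X' : Idx n₁ n₂ n₃ → ℝ}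
    (h : ∀ e, klDensity ν (p (X e)) (p (X' e)) ≠ ∞) (S : Finset (Idx n₁ n₂ n₃)) :
    Integrable (fun y => logLikRatio p X X' ⟨S, y⟩)
      (Measure.pi fun e : S => densityLaw ν (p (X e))) :=
  (integrable_finsetSum Finset.univ fun e _ => integrable_log_ratio_eval hp
    (x := fun e : S => X e) (x' := fun e : S => X' e) (fun e => h e) e).congr
    (logLikRatio_fiber_ae_eq hp h S).symm

lemma integrable_logLikRatio [SigmaFinite ν] (hp : ∀ x, IsProbDensity ν (p x)) {X' : Idx n₁ n₂ n₃ → ℝ}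
    (h : ∀ e, klDensity ν (p (X e)) (p (X' e)) ≠ ∞) :
    Integrable (logLikRatio p X X') (obsLaw ν p X γ) :=
  integrable_obsLaw hp (measurable_logLikRatio hp X') (integrable_logLikRatio_fiber hp h)

lemma integral_logLikRatio [SigmaFinite ν] (hp : ∀ x, IsProbDensity ν (p x)) (hγ0 : 0 ≤ γ) (hγ1 : γ ≤ 1)
    {X' : Idx n₁ n₂ n₃ → ℝ} (h : ∀ e, klDensity ν (p (X e)) (p (X' e)) ≠ ∞) :
    ∫ o, logLikRatio p X X' o ∂(obsLaw ν p X γ) =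
      γ * ∑ e, (klDensity ν (p (X e)) (p (X' e))).toReal := by
  rw [integral_obsLaw hp hγ0 hγ1 (measurable_logLikRatio hp X')
    (integrable_logLikRatio_fiber hp h), ← sum_weight_mul_sum]
  refine Finset.sum_congr rfl fun S _ => ?_
  rw [integral_congr_ae (logLikRatio_fiber_ae_eq hp h S),
    integral_sum_log_ratio hp (x := fun e : S => X e) (x' := fun e : S => X' e) (fun e => h e),
    Finset.sum_coe_sort S fun e => (klDensity ν (p (X e)) (p (X' e))).toReal]
  rfl

lemma exp_neg_half_logLikRatio_fiber_ae_eq (hp : ∀ x, IsProbDensity ν (p x))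
    {X' : Idx n₁ n₂ n₃ → ℝ} (h : ∀ e, klDensity ν (p (X e)) (p (X' e)) ≠ ∞)
    (S : Finset (Idx n₁ n₂ n₃)) :
    (fun y => Real.exp (-logLikRatio p X X' ⟨S, y⟩ / 2))
      =ᵐ[Measure.pi fun e : S => densityLaw ν (p (X e))]
      fun y => ∏ e : S, √(p (X' e) (y e) / p (X e) (y e)) := by
  filter_upwards [ae_prodDensity_pos hp (x := fun e : S => X e) (x' := fun e : S => X' e)
    (fun e => h e), logLikRatio_fiber_ae_eq hp h S] with y hy hlog
  rw [hlog, ← Finset.sum_neg_distrib, Finset.sum_div, Real.exp_sum]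
  refine Finset.prod_congr rfl fun e _ => ?_
  rw [← Real.log_inv, inv_div, exp_half_log (div_pos (hy.2 e) (hy.1 e))]

lemma integrable_exp_neg_half_logLikRatio_fiber (hp : ∀ x, IsProbDensity ν (p x))
    {X' : Idx n₁ n₂ n₃ → ℝ} (h : ∀ e, klDensity ν (p (X e)) (p (X' e)) ≠ ∞)
    (S : Finset (Idx n₁ n₂ n₃)) :
    Integrable (fun y => Real.exp (-logLikRatio p X X' ⟨S, y⟩ / 2))
      (Measure.pi fun e : S => densityLaw ν (p (X e))) := by
  have := fun x => (hp x).isProbabilityMeasure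
  refine Integrable.congr ?_ (exp_neg_half_logLikRatio_fiber_ae_eq hp h S).symm
  exact Integrable.fintype_prod (f := fun (e : S) y => √(p (X' e) y / p (X e) y))
    fun e => integrable_sqrt_ratio (hp _) (hp _)

lemma integral_exp_neg_half_logLikRatio_fiber (hp : ∀ x, IsProbDensity ν (p x))
    {X' : Idx n₁ n₂ n₃ → ℝ} (h : ∀ e, klDensity ν (p (X e)) (p (X' e)) ≠ ∞)
    (S : Finset (Idx n₁ n₂ n₃)) :
    ∫ y, Real.exp (-logLikRatio p X X' ⟨S, y⟩ / 2)
      ∂(Measure.pi fun e : S => densityLaw ν (p (X e))) =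
      ∏ e ∈ S, hellingerAffinity ν (p (X e)) (p (X' e)) := by
  have := fun x => (hp x).isProbabilityMeasure
  rw [integral_congr_ae (exp_neg_half_logLikRatio_fiber_ae_eq hp h S),
    integral_fintype_prod_eq_prod (μ := fun e : S => densityLaw ν (p (X e)))
      (fun (e : S) y => √(p (X' e) y / p (X e) y)),
    ← Finset.prod_coe_sort S fun e => hellingerAffinity ν (p (X e)) (p (X' e))]
  rfl

/-- Affinity loss accumulated over the sampled entries is an exact exponential compensator of the
log-likelihood ratio. -/
lemma integrable_and_integral_exp_compensated [SigmaFinite ν] (hp : ∀ x, IsProbDensity ν (p x)) (hγ0 : 0 ≤ γ)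
    (hγ1 : γ ≤ 1) {X' : Idx n₁ n₂ n₃ → ℝ} (h : ∀ e, klDensity ν (p (X e)) (p (X' e)) ≠ ∞)
    (c : ℝ) :
    Integrable (fun o : Obs n₁ n₂ n₃ 𝓨 => Real.exp (-logLikRatio p X X' o / 2 -
        ∑ e ∈ o.1, Real.log (hellingerAffinity ν (p (X e)) (p (X' e))) - c)) (obsLaw ν p X γ) ∧
      ∫ o, Real.exp (-logLikRatio p X X' o / 2 -
        ∑ e ∈ o.1, Real.log (hellingerAffinity ν (p (X e)) (p (X' e))) - c) ∂(obsLaw ν p X γ) =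
        Real.exp (-c) := by
  have hpos : ∀ e, 0 < hellingerAffinity ν (p (X e)) (p (X' e)) := fun e =>
    (Real.exp_pos _).trans_le (exp_neg_half_kl_le_hellingerAffinity (hp _) (hp _) (h e))
  set L : Idx n₁ n₂ n₃ → ℝ := fun e => Real.log (hellingerAffinity ν (p (X e)) (p (X' e)))
  have hmeas : Measurable fun o : Obs n₁ n₂ n₃ 𝓨 =>
      Real.exp (-logLikRatio p X X' o / 2 - ∑ e ∈ o.1, L e - c) := by
    have : Measurable fun o : Obs n₁ n₂ n₃ 𝓨 => ∑ e ∈ o.1, L e :=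
      measurable_of_sample fun S => ∑ e ∈ S, L e
    exact (((measurable_logLikRatio hp X').neg.div_const 2).sub this |>.sub_const c).exp
  have hfac : ∀ (S : Finset (Idx n₁ n₂ n₃)) (y : S → 𝓨),
      Real.exp (-logLikRatio p X X' ⟨S, y⟩ / 2 - ∑ e ∈ S, L e - c) =
        Real.exp (-logLikRatio p X X' ⟨S, y⟩ / 2) * Real.exp (-∑ e ∈ S, L e - c) := by
    intro S y
    rw [← Real.exp_add]
    ring_nf
  have hint : ∀ S : Finset (Idx n₁ n₂ n₃), Integrable
      (fun y => Real.exp (-logLikRatio p X X' ⟨S, y⟩ / 2 - ∑ e ∈ S, L e - c))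
      (Measure.pi fun e : S => densityLaw ν (p (X e))) := by
    intro S
    simp_rw [hfac]
    exact (integrable_exp_neg_half_logLikRatio_fiber hp h S).mul_const _
  refine ⟨integrable_obsLaw hp hmeas hint, ?_⟩
  rw [integral_obsLaw hp hγ0 hγ1 hmeas hint]
  -- Given `S`, the product of affinities over `S` cancels the compensator exactly, so the result
  -- does not depend on `S` and the sampling weights sum to one.
  have hS : ∀ S : Finset (Idx n₁ n₂ n₃), ∫ y, Real.exp (-logLikRatio p X X' ⟨S, y⟩ / 2 -
      ∑ e ∈ S, L e - c) ∂(Measure.pi fun e : S => densityLaw ν (p (X e))) = Real.exp (-c) := by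
    intro S
    simp_rw [hfac]
    rw [integral_mul_const, integral_exp_neg_half_logLikRatio_fiber hp h,
      ← Real.exp_log (Finset.prod_pos fun e _ => hpos e),
      Real.log_prod fun e _ => (hpos e).ne', ← Real.exp_add]
    simp only [L]
    ring_nf
  simp_rw [hS]
  rw [← Finset.sum_mul]
  simp only [bernoulliWeight]
  rw [sum_weight_eq_one, one_mul]

lemma integrable_of_sample [SigmaFinite ν] (hp : ∀ x, IsProbDensity ν (p x)) (f : Finset (Idx n₁ n₂ n₃) → ℝ) :
    Integrable (fun o : Obs n₁ n₂ n₃ 𝓨 => f o.1) (obsLaw ν p X γ) := by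
  have := fun x => (hp x).isProbabilityMeasure
  exact integrable_obsLaw hp (measurable_of_sample f) fun S =>
    integrable_const (f S)

lemma integral_of_sample [SigmaFinite ν] (hp : ∀ x, IsProbDensity ν (p x)) (hγ0 : 0 ≤ γ) (hγ1 : γ ≤ 1)
    (f : Finset (Idx n₁ n₂ n₃) → ℝ) :
    ∫ o, f o.1 ∂(obsLaw ν p X γ) = ∑ S, bernoulliWeight γ S * f S := by
  have := fun x => (hp x).isProbabilityMeasure
  rw [integral_obsLaw hp hγ0 hγ1 (measurable_of_sample f) fun S =>
    integrable_const (f S)]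
  simp

end Observations

/-! ### Counting candidates: the Kraft inequality. -/

section Kraft

variable {n₁ n₂ n₃ F : ℕ}

lemma sum_piFinset_prod_const {ι : Type*} [Fintype ι] [DecidableEq ι] (T : Finset ℝ) (q : ℝ) :
    ∑ _x ∈ Fintype.piFinset (fun _ : ι => T), ∏ _i : ι, q = (T.card * q) ^ Fintype.card ι := by
  rw [← Finset.prod_univ_sum (fun _ : ι => T) (fun _ _ => q)]
  simp

lemma sum_piFinset_pow_nonzero_le {ι : Type*} [Fintype ι] [DecidableEq ι] (T : Finset ℝ) {q : ℝ}
    (hq : 0 ≤ q) :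
    ∑ x ∈ Fintype.piFinset (fun _ : ι => insert 0 T), ∏ i, (if x i ≠ 0 then q else 1) ≤
      (1 + T.card * q) ^ Fintype.card ι := by
  rw [← Finset.prod_univ_sum (fun _ : ι => insert 0 T) (fun _ c => if c ≠ 0 then q else 1)]
  simp only [Finset.prod_const, Finset.card_univ]
  have hnn : ∀ c : ℝ, 0 ≤ if c ≠ 0 then q else 1 := fun c => by split_ifs <;> linarith
  refine pow_le_pow_left₀ (Finset.sum_nonneg fun c _ => hnn c) ?_ _
  -- `0` may itself belong to `T`; it is split off with weight 1 so that only nonzero values carry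
  -- the factor `q`.
  rw [← Finset.insert_erase (Finset.mem_insert_self 0 T), Finset.sum_insert (by simp)]
  have h1 : ∑ c ∈ (insert 0 T).erase 0, (if c ≠ 0 then q else 1) ≤ ∑ _c ∈ T, q := by
    rw [Finset.sum_congr rfl fun c hc => if_pos (Finset.ne_of_mem_erase hc)]
    exact Finset.sum_le_sum_of_subset_of_nonneg
      (by intro c hc; simp only [Finset.mem_erase, Finset.mem_insert] at hc; tauto) fun _ _ _ => hq
  simp only [Finset.sum_const, nsmul_eq_mul] at h1
  simpa using h1

lemma pow_l0norm {k l : ℕ} (C : Matrix (Fin k) (Fin l) ℝ) (q : ℝ) :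
    q ^ l0norm C = ∏ e : Fin k × Fin l, if C e.1 e.2 ≠ 0 then q else 1 := by
  rw [Finset.prod_ite, Finset.prod_const, Finset.prod_const_one, mul_one, l0norm]

/-- Candidates embed injectively in a product grid with one coordinate per factor entry. The weight
is a product over these coordinates, so its sum over the grid factors; a zero entry of `C` costs
nothing, whence `1 + TC.card * q`. -/
lemma sum_pow_complexity_le (𝒳 : Finset (CPFactors n₁ n₂ n₃ F)) (TA TB TC : Finset ℝ)
    (hA : ∀ t ∈ 𝒳, ∀ i f, t.A i f ∈ TA) (hB : ∀ t ∈ 𝒳, ∀ i f, t.B i f ∈ TB)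
    (hC : ∀ t ∈ 𝒳, ∀ i f, t.C i f ∈ insert 0 TC) {q : ℝ} (hq : 0 ≤ q) :
    ∑ t ∈ 𝒳, q ^ ((n₁ + n₂) * F + l0norm t.C) ≤
      (TA.card * q) ^ (n₁ * F) * ((TB.card * q) ^ (n₂ * F) * (1 + TC.card * q) ^ (n₃ * F)) := by
  let PA := Fintype.piFinset (fun _ : Fin n₁ × Fin F => TA)
  let PB := Fintype.piFinset (fun _ : Fin n₂ × Fin F => TB)
  let PC := Fintype.piFinset (fun _ : Fin n₃ × Fin F => insert 0 TC)
  let φ : CPFactors n₁ n₂ n₃ F →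
      (Fin n₁ × Fin F → ℝ) × (Fin n₂ × Fin F → ℝ) × (Fin n₃ × Fin F → ℝ) :=
    fun t => (fun e => t.A e.1 e.2, fun e => t.B e.1 e.2, fun e => t.C e.1 e.2)
  let G : (Fin n₁ × Fin F → ℝ) × (Fin n₂ × Fin F → ℝ) × (Fin n₃ × Fin F → ℝ) → ℝ :=
    fun x => (∏ _i : Fin n₁ × Fin F, q) *
      ((∏ _i : Fin n₂ × Fin F, q) * ∏ i, (if x.2.2 i ≠ 0 then q else 1))
  have hφ : Function.Injective φ := by
    intro s t h
    simp only [φ, Prod.mk.injEq, funext_iff] at h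
    ext i f
    · exact h.1 (i, f)
    · exact h.2.1 (i, f)
    · exact h.2.2 (i, f)
  have hG : ∀ x, 0 ≤ G x := fun x =>
    mul_nonneg (Finset.prod_nonneg fun _ _ => hq) (mul_nonneg (Finset.prod_nonneg fun _ _ => hq)
      (Finset.prod_nonneg fun i _ => by split_ifs <;> linarith))
  have h1 : ∀ t ∈ 𝒳, q ^ ((n₁ + n₂) * F + l0norm t.C) = G (φ t) := by
    intro t _
    simp only [G, φ, Finset.prod_const, Finset.card_univ, Fintype.card_prod, Fintype.card_fin]
    rw [← pow_l0norm]
    ring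
  rw [Finset.sum_congr rfl h1, ← Finset.sum_image (f := G) hφ.injOn]
  have hsub : 𝒳.image φ ⊆ PA ×ˢ PB ×ˢ PC := by
    intro x hx
    obtain ⟨t, ht, rfl⟩ := Finset.mem_image.1 hx
    simp only [Finset.mem_product, PA, PB, PC, Fintype.mem_piFinset, φ]
    exact ⟨fun e => hA t ht _ _, fun e => hB t ht _ _, fun e => hC t ht _ _⟩
  refine (Finset.sum_le_sum_of_subset_of_nonneg hsub fun x _ _ => hG x).trans ?_
  have h2 : ∑ x ∈ PA ×ˢ PB ×ˢ PC, G x = (∑ _x ∈ PA, ∏ _i : Fin n₁ × Fin F, q) *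
      ((∑ _x ∈ PB, ∏ _i : Fin n₂ × Fin F, q) *
        ∑ x ∈ PC, ∏ i, (if x i ≠ 0 then q else 1)) := by
    rw [Finset.sum_mul_sum, Finset.sum_mul_sum, Finset.sum_product]
    refine Finset.sum_congr rfl fun x _ => ?_
    rw [← Finset.mul_sum, Finset.sum_product, ← Finset.mul_sum]
  rw [h2, sum_piFinset_prod_const, sum_piFinset_prod_const]
  have h3 := sum_piFinset_pow_nonzero_le (ι := Fin n₃ × Fin F) TC hq
  simp only [Fintype.card_prod, Fintype.card_fin] at h3 ⊢
  gcongr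

/-- The set of levels as a finset. -/
def levelFinset (L : ℕ) (M : ℝ) : Finset ℝ :=
  Finset.univ.image fun i : Fin L => -M + 2 * M * (i : ℝ) / ((L : ℝ) - 1)

lemma mem_levelFinset {L : ℕ} {M x : ℝ} (hx : x ∈ levels L M) : x ∈ levelFinset L M := by
  obtain ⟨i, rfl⟩ := hx
  exact Finset.mem_image_of_mem _ (Finset.mem_univ i)

lemma card_levelFinset_le (L : ℕ) (M : ℝ) : (levelFinset L M).card ≤ L :=
  Finset.card_image_le.trans (by simp)

/-- Rounding the exponent up at most doubles `n ^ β`, and `2 ≤ n` absorbs the doubling. -/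
lemma levelCount_le {n : ℕ} (hn : 2 ≤ n) {β : ℝ} (hβ : 1 ≤ β) :
    (levelCount n β : ℝ) ≤ (n : ℝ) ^ (β + 1) := by
  have hn2 : (2 : ℝ) ≤ n := by exact_mod_cast hn
  have hpos : (0 : ℝ) < (n : ℝ) ^ β := Real.rpow_pos_of_pos (by linarith) _
  have hone : 1 ≤ (n : ℝ) ^ β := Real.one_le_rpow (by linarith) (by linarith)
  have h0 : 0 ≤ Real.logb 2 ((n : ℝ) ^ β) := Real.logb_nonneg one_lt_two hone
  rw [levelCount, Nat.cast_pow, Nat.cast_ofNat, ← Real.rpow_natCast]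
  refine (Real.rpow_le_rpow_of_exponent_le one_le_two (Nat.ceil_lt_add_one h0).le).trans ?_
  rw [Real.rpow_add two_pos, Real.rpow_logb two_pos (by norm_num) hpos, Real.rpow_one,
    Real.rpow_add (by linarith), Real.rpow_one]
  gcongr

lemma levelCount_mul_exp_le {n : ℕ} (hn : 2 ≤ n) {β : ℝ} (hβ : 1 ≤ β) :
    (levelCount n β : ℝ) * Real.exp (-(2 * (β + 2) * Real.log n)) ≤ 1 / (n : ℝ) ^ 4 := by
  have hn2 : (2 : ℝ) ≤ n := by exact_mod_cast hn
  have hn0 : (0 : ℝ) < n := by linarith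
  have h1 : Real.exp (-(2 * (β + 2) * Real.log n)) = (n : ℝ) ^ (-(2 * (β + 2))) := by
    rw [Real.rpow_def_of_pos hn0]
    ring_nf
  rw [h1]
  refine (mul_le_mul_of_nonneg_right (levelCount_le hn hβ) (Real.rpow_pos_of_pos hn0 _).le).trans ?_
  rw [← Real.rpow_add hn0, one_div, ← Real.rpow_natCast, ← Real.rpow_neg hn0.le]
  exact Real.rpow_le_rpow_of_exponent_le (by linarith) (by push_cast; linarith)

lemma one_add_pow_le_three {δ : ℝ} {k : ℕ} (h0 : 0 ≤ δ) (h : k * δ ≤ 1) : (1 + δ) ^ k ≤ 3 := by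
  have h1 : (1 + δ) ^ k ≤ Real.exp (k * δ) := by
    rw [Real.exp_nat_mul]
    exact pow_le_pow_left₀ (by linarith) (by linarith [Real.add_one_le_exp δ]) _
  have h2 := Real.exp_le_exp.2 h
  have h3 := Real.exp_one_lt_d9
  linarith

/-- Kraft inequality for the candidate class. -/
lemma sum_exp_neg_penalty_le_one (hn : 2 ≤ nMax n₁ n₂ n₃ F) (hn₁ : 1 ≤ n₁)
    {β Amax Bmax Cmax Xmax : ℝ} (hβ : 1 ≤ β) (𝒳 : Finset (CPFactors n₁ n₂ n₃ F))
    (h𝒳 : ∀ t ∈ 𝒳, t ∈ candidates n₁ n₂ n₃ F β Amax Bmax Cmax Xmax) :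
    ∑ t ∈ 𝒳, Real.exp (-(2 * (β + 2) * Real.log (nMax n₁ n₂ n₃ F) *
      (((n₁ : ℝ) + n₂) * F + l0norm t.C))) ≤ 1 := by
  set n := nMax n₁ n₂ n₃ F with hndef
  set L := levelCount n β
  set q := Real.exp (-(2 * (β + 2) * Real.log n)) with hqdef
  have hq : 0 ≤ q := (Real.exp_pos _).le
  have hn2 : (2 : ℝ) ≤ n := by exact_mod_cast hn
  have hδ : L * q ≤ 1 / (n : ℝ) ^ 4 := levelCount_mul_exp_le hn hβ
  have hδ0 : 0 ≤ L * q := mul_nonneg (Nat.cast_nonneg _) hq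
  have hδ16 : L * q ≤ 1 / 16 := hδ.trans (by
    rw [div_le_div_iff_of_pos_left one_pos (by positivity) (by norm_num)]
    calc (16 : ℝ) = 2 ^ 4 := by norm_num
      _ ≤ (n : ℝ) ^ 4 := pow_le_pow_left₀ (by norm_num) hn2 4)
  have h1 : ∀ t ∈ 𝒳, Real.exp (-(2 * (β + 2) * Real.log n *
      (((n₁ : ℝ) + n₂) * F + l0norm t.C))) = q ^ ((n₁ + n₂) * F + l0norm t.C) := by
    intro t _
    rw [hqdef, ← Real.exp_nat_mul]
    push_cast
    ring_nf
  rw [Finset.sum_congr rfl h1]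
  have h2 := sum_pow_complexity_le 𝒳 (levelFinset L Amax) (levelFinset L Bmax)
    (levelFinset L Cmax) (fun t ht i f => mem_levelFinset ((h𝒳 t ht).1 i f))
    (fun t ht i f => mem_levelFinset ((h𝒳 t ht).2.1 i f))
    (fun t ht i f => Finset.mem_insert.2 (((h𝒳 t ht).2.2.1 i f).imp id mem_levelFinset)) hq
  have hcard : ∀ M, ((levelFinset L M).card : ℝ) * q ≤ L * q := fun M =>
    mul_le_mul_of_nonneg_right (by exact_mod_cast card_levelFinset_le L M) hq
  have hcard0 : ∀ M, 0 ≤ ((levelFinset L M).card : ℝ) * q := fun M =>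
    mul_nonneg (Nat.cast_nonneg _) hq
  refine h2.trans ?_
  rcases Nat.eq_zero_or_pos F with hF | hF
  · simp [hF]
  have e1 : ((levelFinset L Amax).card * q) ^ (n₁ * F) ≤ 1 / 16 := by
    refine (pow_le_pow_left₀ (hcard0 _) (hcard _) _).trans ?_
    refine (pow_le_of_le_one hδ0 (by linarith) (Nat.mul_pos hn₁ hF).ne').trans hδ16
  have e2 : ((levelFinset L Bmax).card * q) ^ (n₂ * F) ≤ 1 :=
    pow_le_one₀ (hcard0 _) ((hcard _).trans (by linarith))
  have e3 : (1 + (levelFinset L Cmax).card * q) ^ (n₃ * F) ≤ 3 := by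
    refine one_add_pow_le_three (hcard0 _) ?_
    have h3 : (n₃ : ℝ) ≤ n := by
      exact_mod_cast (le_max_left n₃ F).trans (le_max_right (max n₁ n₂) _)
    have h4 : (F : ℝ) ≤ n := by
      exact_mod_cast (le_max_right n₃ F).trans (le_max_right (max n₁ n₂) _)
    -- At most `n ^ 2` entries of `C`, each contributing at most `n ^ (-4)`, keep the `C` factor
    -- below `exp 1 < 3`.
    calc ((n₃ * F : ℕ) : ℝ) * ((levelFinset L Cmax).card * q)
        ≤ (n * n) * (1 / (n : ℝ) ^ 4) := by
          push_cast
          exact mul_le_mul (by gcongr) ((hcard _).trans hδ) (hcard0 _) (by positivity)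
      _ = 1 / (n : ℝ) ^ 2 := by
          have : (n : ℝ) ≠ 0 := by linarith
          field_simp
      _ ≤ 1 := by
          rw [div_le_one (by positivity)]
          nlinarith
  have f2 := pow_nonneg (hcard0 Bmax) (n₂ * F)
  have f3 : 0 ≤ (1 + (levelFinset L Cmax).card * q) ^ (n₃ * F) :=
    pow_nonneg (by linarith [hcard0 Cmax]) _
  calc _ ≤ (1 / 16 : ℝ) * (1 * 3) := by gcongr
    _ ≤ 1 := by norm_num

end Kraft

/-! ### The oracle inequality for an abstract penalty. -/

section OracleInequality

variable {𝓨 : Type*} [MeasurableSpace 𝓨] {ν : Measure 𝓨} {p : ℝ → 𝓨 → ℝ} {n₁ n₂ n₃ : ℕ}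

/-- The affinity loss `-2 log A(p_x, p_{x'})` of a single entry. -/
def affinityLoss (ν : Measure 𝓨) (p : ℝ → 𝓨 → ℝ) (x x' : ℝ) : ℝ :=
  -2 * Real.log (hellingerAffinity ν (p x) (p x'))

lemma affinityLoss_nonneg (hp : ∀ x, IsProbDensity ν (p x)) (x x' : ℝ) :
    0 ≤ affinityLoss ν p x x' := by
  have := Real.log_nonpos (integral_nonneg fun _ => Real.sqrt_nonneg _)
    (hellingerAffinity_le_one (hp x) (hp x'))
  unfold affinityLoss hellingerAffinity at *
  linarith

lemma affinityLoss_le_kl (hp : ∀ x, IsProbDensity ν (p x)) {x x' : ℝ}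
    (h : klDensity ν (p x) (p x') ≠ ∞) :
    affinityLoss ν p x x' ≤ (klDensity ν (p x) (p x')).toReal := by
  have h1 := Real.log_le_log (Real.exp_pos _)
    (exp_neg_half_kl_le_hellingerAffinity (hp x) (hp x') h)
  rw [Real.log_exp] at h1
  unfold affinityLoss
  linarith

lemma hellingerAffinity_pos (hp : ∀ x, IsProbDensity ν (p x)) {x x' : ℝ}
    (h : klDensity ν (p x) (p x') ≠ ∞) : 0 < hellingerAffinity ν (p x) (p x') :=
  (Real.exp_pos _).trans_le (exp_neg_half_kl_le_hellingerAffinity (hp _) (hp _) h)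

lemma affinityTensor_eq_prod [SigmaFinite ν] (hp : ∀ x, IsProbDensity ν (p x))
    (X X' : Idx n₁ n₂ n₃ → ℝ) :
    affinityTensor ν p X' X = ∏ e, hellingerAffinity ν (p (X e)) (p (X' e)) := by
  rw [affinityTensor, hellingerAffinity_prodDensity hp]
  exact Finset.prod_congr rfl fun e _ => hellingerAffinity_comm (hp _) (hp _)

lemma neg_two_mul_log_affinityTensor [SigmaFinite ν] (hp : ∀ x, IsProbDensity ν (p x))
    {X X' : Idx n₁ n₂ n₃ → ℝ} (h : ∀ e, klDensity ν (p (X e)) (p (X' e)) ≠ ∞) :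
    -2 * Real.log (affinityTensor ν p X' X) = ∑ e, affinityLoss ν p (X e) (X' e) := by
  rw [affinityTensor_eq_prod hp, Real.log_prod fun e _ => (hellingerAffinity_pos hp (h e)).ne',
    Finset.mul_sum]
  rfl

/-- Oracle inequality for penalized likelihood selection under Bernoulli sampling, for penalties
`W` dominating a Kraft-summable complexity `pen`. -/
lemma oracle_inequality [SigmaFinite ν] (hp : ∀ x, IsProbDensity ν (p x))
    {X : Idx n₁ n₂ n₃ → ℝ} {γ : ℝ} (hγ0 : 0 < γ) (hγ1 : γ ≤ 1) {T : Type*} {𝒳 : Finset T}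
    {τ : T → Idx n₁ n₂ n₃ → ℝ} {QD : ℝ≥0}
    (hQD : ∀ t ∈ 𝒳, ∀ e, klDensity ν (p (X e)) (p (τ t e)) ≤ (QD : ℝ≥0∞))
    {est : Obs n₁ n₂ n₃ 𝓨 → T} (hmeas : ∀ t, MeasurableSet (est ⁻¹' {t}))
    (hmem : ∀ o, est o ∈ 𝒳) {pen W : T → ℝ} (hpen : ∀ t ∈ 𝒳, 0 ≤ pen t)
    (hkraft : ∑ t ∈ 𝒳, Real.exp (-pen t) ≤ 1)
    (hW : ∀ t ∈ 𝒳, 2 * (1 + 2 * (QD : ℝ) / 3) * pen t ≤ W t) {t₀ : T} (ht₀ : t₀ ∈ 𝒳)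
    (hmin : ∀ᵐ o ∂(obsLaw ν p X γ), logLikRatio p X (τ (est o)) o + W (est o) ≤
      logLikRatio p X (τ t₀) o + W t₀) :
    ∫ o, ∑ e, affinityLoss ν p (X e) (τ (est o) e) ∂(obsLaw ν p X γ) ≤
      3 * (∑ e, (klDensity ν (p (X e)) (p (τ t₀ e))).toReal + W t₀ / γ) := by
  have hprob := isProbabilityMeasure_obsLaw (X := X) hp hγ0.le hγ1
  have hfin : ∀ t ∈ 𝒳, ∀ e, klDensity ν (p (X e)) (p (τ t e)) ≠ ∞ := fun t ht e =>
    ((hQD t ht e).trans_lt ENNReal.coe_lt_top).ne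
  have haQ : ∀ t ∈ 𝒳, ∀ e, affinityLoss ν p (X e) (τ t e) ≤ QD := fun t ht e =>
    (affinityLoss_le_kl hp (hfin t ht e)).trans
      (ENNReal.toReal_le_of_le_ofReal QD.2 (by simpa using hQD t ht e))
  have hW0 : 0 ≤ W t₀ := le_trans (mul_nonneg (by positivity) (hpen t₀ ht₀)) (hW t₀ ht₀)
  -- `QD = 0` is treated apart because the scale `3 / (4 Q)` below would degenerate; the loss is
  -- then identically zero.
  rcases eq_or_lt_of_le (NNReal.coe_nonneg QD) with hQ0 | hQ0
  · have h0 : ∀ o, ∑ e, affinityLoss ν p (X e) (τ (est o) e) = 0 := fun o =>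
      Finset.sum_eq_zero fun e _ => le_antisymm ((haQ _ (hmem o) e).trans hQ0.ge)
        (affinityLoss_nonneg hp _ _)
    simp_rw [h0]
    rw [integral_zero]
    positivity
  set Q : ℝ := (QD : ℝ)
  -- Since `a ≤ Q`, this scale gives `s * a ≤ 3/4`, as the sampling bound requires. Its inverse `4 Q
  -- / 3` multiplies `pen` and accounts for the term `2 QD / 3` in the condition on the penalty.
  set s : ℝ := 3 / (4 * Q) with hs
  have hs0 : 0 < s := by positivity
  let a : T → Idx n₁ n₂ n₃ → ℝ := fun t e => affinityLoss ν p (X e) (τ t e)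
  let Z₁ : T → Obs n₁ n₂ n₃ 𝓨 → ℝ := fun t o => -logLikRatio p X (τ t) o / 2 -
    ∑ e ∈ o.1, Real.log (hellingerAffinity ν (p (X e)) (p (τ t e))) - pen t
  let Z₂ : T → Obs n₁ n₂ n₃ 𝓨 → ℝ := fun t o =>
    s * (γ * (∑ e, a t e) / 3 - ∑ e ∈ o.1, a t e) - pen t
  have hZ₁int : ∀ t ∈ 𝒳, Integrable (Z₁ t) (obsLaw ν p X γ) := fun t ht =>
    (((integrable_logLikRatio hp (hfin t ht)).neg.div_const 2).sub
      (integrable_of_sample hp fun S =>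
        ∑ e ∈ S, Real.log (hellingerAffinity ν (p (X e)) (p (τ t e))))).sub
      (integrable_const (pen t))
  have hZ₂int : ∀ t ∈ 𝒳, Integrable (Z₂ t) (obsLaw ν p X γ) := fun t _ =>
    integrable_of_sample hp fun S => s * (γ * (∑ e, a t e) / 3 - ∑ e ∈ S, a t e) - pen t
  have hZ₁ := integral_select_nonpos hmeas hmem hZ₁int
    (fun t ht => (integrable_and_integral_exp_compensated hp hγ0.le hγ1 (hfin t ht) (pen t)).1)
    (fun t ht =>
      (integrable_and_integral_exp_compensated hp hγ0.le hγ1 (hfin t ht) (pen t)).2.le) hkraft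
  have hZ₂ := integral_select_nonpos hmeas hmem hZ₂int
    (fun t _ => integrable_of_sample hp fun S =>
      Real.exp (s * (γ * (∑ e, a t e) / 3 - ∑ e ∈ S, a t e) - pen t))
    (c := fun t => Real.exp (-pen t)) (fun t ht => by
      rw [integral_of_sample hp hγ0.le hγ1 fun S =>
        Real.exp (s * (γ * (∑ e, a t e) / 3 - ∑ e ∈ S, a t e) - pen t)]
      simp_rw [sub_eq_add_neg _ (pen t), Real.exp_add, ← mul_assoc]
      rw [← Finset.sum_mul]
      refine mul_le_of_le_one_left (Real.exp_pos _).le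
        (sum_weight_mul_exp_le_one hγ0.le hγ1
          (fun e => mul_nonneg hs0.le (affinityLoss_nonneg hp _ _)) fun e => ?_)
      refine (mul_le_mul_of_nonneg_left (haQ t ht e) hs0.le).trans_eq ?_
      have := hQ0.ne'
      rw [hs]
      field_simp) hkraft
  have hA : Integrable (fun o => γ / 3 * ∑ e, a (est o) e) (obsLaw ν p X γ) :=
    (integrable_select hmeas hmem (f := fun t _ => ∑ e, a t e)
      fun t _ => integrable_const _).const_mul _
  have i₁ := integrable_select hmeas hmem hZ₁int
  have i₂ := integrable_select hmeas hmem hZ₂int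
  have i₃ := integrable_logLikRatio (γ := γ) hp (hfin t₀ ht₀)
  have i₁₂ : Integrable (fun o => 2 * Z₁ (est o) o + s⁻¹ * Z₂ (est o) o) (obsLaw ν p X γ) :=
    (i₁.const_mul 2).add (i₂.const_mul s⁻¹)
  have i₄ : Integrable (fun o => logLikRatio p X (τ t₀) o + W t₀) (obsLaw ν p X γ) :=
    i₃.add (integrable_const _)
  have key : ∫ o, γ / 3 * ∑ e, a (est o) e ∂(obsLaw ν p X γ) ≤
      ∫ o, (2 * Z₁ (est o) o + s⁻¹ * Z₂ (est o) o + (logLikRatio p X (τ t₀) o + W t₀))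
        ∂(obsLaw ν p X γ) := by
    refine integral_mono_ae hA (i₁₂.add i₄) ?_
    filter_upwards [hmin] with o ho
    have hWo := hW _ (hmem o)
    have e1 : ∑ e ∈ o.1, a (est o) e =
        -2 * ∑ e ∈ o.1, Real.log (hellingerAffinity ν (p (X e)) (p (τ (est o) e))) := by
      rw [Finset.mul_sum]
      rfl
    have e2 : s⁻¹ * Z₂ (est o) o =
        γ * (∑ e, a (est o) e) / 3 - ∑ e ∈ o.1, a (est o) e - 4 * Q / 3 * pen (est o) := by
      simp only [Z₂]
      rw [mul_sub, inv_mul_cancel_left₀ hs0.ne', hs, inv_div]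
    -- The losses over the sampled entries cancel. The total charge `(2 + 4 Q / 3) * pen` is at most
    -- `W` by `hW`, and minimality of the estimator replaces its criterion by that of `t₀`.
    rw [e2, e1]
    simp only [Z₁]
    linarith
  rw [integral_const_mul, integral_add i₁₂ i₄, integral_add (i₁.const_mul 2) (i₂.const_mul s⁻¹),
    integral_add i₃ (integrable_const (W t₀)), integral_const_mul, integral_const_mul,
    integral_logLikRatio hp hγ0.le hγ1 (hfin t₀ ht₀)] at key
  simp only [integral_const, probReal_univ, one_smul] at key
  have hZ₂' := mul_nonpos_of_nonneg_of_nonpos (inv_nonneg.2 hs0.le) hZ₂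
  have key' : γ / 3 * ∫ o, ∑ e, a (est o) e ∂(obsLaw ν p X γ) ≤
      γ * ∑ e, (klDensity ν (p (X e)) (p (τ t₀ e))).toReal + W t₀ := by linarith
  have : γ / 3 * (3 * (∑ e, (klDensity ν (p (X e)) (p (τ t₀ e))).toReal + W t₀ / γ)) =
      γ * ∑ e, (klDensity ν (p (X e)) (p (τ t₀ e))).toReal + W t₀ := by
    field_simp
  rw [← this] at key'
  exact le_of_mul_le_mul_left key' (by positivity)

lemma penalizedNegLogLik_of_pos {𝓨 : Type*} {F : ℕ} {p : ℝ → 𝓨 → ℝ} {lam : ℝ}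
    {o : Obs n₁ n₂ n₃ 𝓨} {t : CPFactors n₁ n₂ n₃ F} (h : 0 < likelihood p t.tensor o) :
    penalizedNegLogLik p lam o t =
      ((-Real.log (likelihood p t.tensor o) + lam * l0norm t.C : ℝ) : EReal) := by
  rw [penalizedNegLogLik, ENNReal.log_pos_real' (by rwa [ENNReal.toReal_ofReal h.le]),
    ENNReal.toReal_ofReal h.le]
  push_cast
  rfl

end OracleInequality

end SparseCP

end

/-! ### Specialization to sparse CP factors. -/

open SparseCP in
theorem theorem1 {n₁ n₂ n₃ F : ℕ} (hn : 2 ≤ nMax n₁ n₂ n₃ F)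
    {𝓨 : Type*} [MeasurableSpace 𝓨] (ν : Measure 𝓨) [SigmaFinite ν]
    (p : ℝ → 𝓨 → ℝ) (hp : ∀ x, IsProbDensity ν (p x))
    (Xstar : Idx n₁ n₂ n₃ → ℝ)
    (β Amax Bmax Cmax Xmax : ℝ) (hβ : 1 ≤ β)
    (𝒳 : Finset (CPFactors n₁ n₂ n₃ F)) (h𝒳 : 𝒳.Nonempty)
    (h𝒳sub : ∀ t ∈ 𝒳, t ∈ candidates n₁ n₂ n₃ F β Amax Bmax Cmax Xmax)
    (m : ℝ) (hm1 : 1 ≤ m) (hm : m ≤ (n₁ : ℝ) * n₂ * n₃)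
    (QD : ℝ≥0)
    (hQD : ∀ t ∈ 𝒳, ∀ e, klDensity ν (p (Xstar e)) (p (t.tensor e)) ≤ (QD : ℝ≥0∞))
    (lam : ℝ)
    (hlam : 4 * (β + 2) * (1 + 2 * (QD : ℝ) / 3) * Real.log (nMax n₁ n₂ n₃ F) ≤ lam)
    (est : Obs n₁ n₂ n₃ 𝓨 → CPFactors n₁ n₂ n₃ F) (hest : IsPenalizedMLE p lam 𝒳 est) :
    (∀ t ∈ 𝒳, klTensor ν p Xstar t.tensor ≠ ∞ ∧ 0 < affinityTensor ν p t.tensor Xstar) ∧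
    Integrable (fun o => -2 * Real.log (affinityTensor ν p (est o).tensor Xstar))
      (obsLaw ν p Xstar (m / ((n₁ : ℝ) * n₂ * n₃))) ∧
    (∫ o, -2 * Real.log (affinityTensor ν p (est o).tensor Xstar)
        ∂(obsLaw ν p Xstar (m / ((n₁ : ℝ) * n₂ * n₃)))) / ((n₁ : ℝ) * n₂ * n₃) ≤
      3 * 𝒳.inf' h𝒳 (fun t =>
        (klTensor ν p Xstar t.tensor).toReal / ((n₁ : ℝ) * n₂ * n₃) +
          (lam + 8 * (QD : ℝ) * (β + 2) * Real.log (nMax n₁ n₂ n₃ F) / 3) *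
            ((((n₁ : ℝ) + n₂) * F + l0norm t.C) / m)) +
      8 * (QD : ℝ) * Real.log m / m := by
  set N : ℝ := (n₁ : ℝ) * n₂ * n₃ with hN
  have hN0 : 0 < N := by linarith
  have hm0 : 0 < m := by linarith
  have hγ0 : 0 < m / N := by positivity
  have hγ1 : m / N ≤ 1 := (div_le_one hN0).2 hm
  have hn₁ : 1 ≤ n₁ := by
    rcases Nat.eq_zero_or_pos n₁ with h | h
    · simp [hN, h] at hN0
    · exact h
  have hfin : ∀ t ∈ 𝒳, ∀ e, klDensity ν (p (Xstar e)) (p (t.tensor e)) ≠ ∞ := fun t ht e =>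
    ((hQD t ht e).trans_lt ENNReal.coe_lt_top).ne
  have hprob := isProbabilityMeasure_obsLaw (X := Xstar) hp hγ0.le hγ1
  refine ⟨fun t ht => ⟨klDensity_prodDensity_ne_top hp (hfin t ht), ?_⟩, ?_, ?_⟩
  · rw [affinityTensor_eq_prod hp]
    exact Finset.prod_pos fun e _ => hellingerAffinity_pos hp (hfin t ht e)
  · exact integrable_select hest.measurableSet_fiber hest.mem
      (f := fun t _ => -2 * Real.log (affinityTensor ν p t.tensor Xstar))
      fun t _ => integrable_const _
  obtain ⟨t₀, ht₀, hinf⟩ := Finset.exists_mem_eq_inf' h𝒳 (fun t =>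
        (klTensor ν p Xstar t.tensor).toReal / N +
          (lam + 8 * (QD : ℝ) * (β + 2) * Real.log (nMax n₁ n₂ n₃ F) / 3) *
            ((((n₁ : ℝ) + n₂) * F + l0norm t.C) / m))
  rw [hinf]
  have hlog : 0 ≤ Real.log (nMax n₁ n₂ n₃ F) := Real.log_natCast_nonneg _
  -- The term `(n₁ + n₂) F` is the same for every candidate, so adding it to the penalty leaves the
  -- minimizers unchanged while making the penalty dominate the Kraft complexity.
  let w : CPFactors n₁ n₂ n₃ F → ℝ := fun t => ((n₁ : ℝ) + n₂) * F + l0norm t.C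
  have hw : ∀ t, 0 ≤ w t := fun t => by positivity
  have hmin : ∀ᵐ o ∂(obsLaw ν p Xstar (m / N)),
      logLikRatio p Xstar (est o).tensor o + lam * w (est o) ≤
        logLikRatio p Xstar t₀.tensor o + lam * w t₀ := by
    -- Almost surely every candidate has positive likelihood, so the extended-real objectives are
    -- finite and can be compared as real numbers.
    have hall : ∀ᵐ o ∂(obsLaw ν p Xstar (m / N)), ∀ t ∈ 𝒳, 0 < likelihood p t.tensor o :=
      (Filter.eventually_all_finset 𝒳).2 fun t ht => ae_likelihood_pos hp (hfin t ht)
    have hself : ∀ᵐ o ∂(obsLaw ν p Xstar (m / N)), 0 < likelihood p Xstar o :=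
      ae_likelihood_pos hp fun e => by
        have := (hp (Xstar e)).isProbabilityMeasure
        simp [klDensity, InformationTheory.klDiv_self]
    filter_upwards [hall, hself] with o ho ho'
    have h1 := hest.minimizes o t₀ ht₀
    rw [penalizedNegLogLik_of_pos (ho _ (hest.mem o)), penalizedNegLogLik_of_pos (ho _ ht₀),
      EReal.coe_le_coe_iff] at h1
    rw [logLikRatio, logLikRatio, Real.log_div ho'.ne' (ho _ (hest.mem o)).ne',
      Real.log_div ho'.ne' (ho _ ht₀).ne']
    simp only [w]
    linarith
  have key := oracle_inequality hp hγ0 hγ1 (τ := CPFactors.tensor) hQD hest.measurableSet_fiber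
    hest.mem (pen := fun t => 2 * (β + 2) * Real.log (nMax n₁ n₂ n₃ F) * w t)
    (W := fun t => lam * w t) (fun t _ => by have := hw t; positivity)
    (sum_exp_neg_penalty_le_one hn hn₁ hβ 𝒳 h𝒳sub)
    (fun t _ => by
      have := mul_le_mul_of_nonneg_right hlam (hw t)
      linarith) ht₀ hmin
  have hint : ∫ o, -2 * Real.log (affinityTensor ν p (est o).tensor Xstar)
      ∂(obsLaw ν p Xstar (m / N)) = ∫ o, ∑ e, affinityLoss ν p (Xstar e) ((est o).tensor e)
      ∂(obsLaw ν p Xstar (m / N)) :=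
    integral_congr_ae (ae_of_all _ fun o =>
      neg_two_mul_log_affinityTensor hp (hfin _ (hest.mem o)))
  rw [hint, klTensor, toReal_klDensity_prodDensity hp (hfin t₀ ht₀)]
  refine (div_le_div_of_nonneg_right key hN0.le).trans ?_
  -- The bound already holds without this term and the next one; their nonnegativity suffices to
  -- reach the stated form.
  have hlogm : 0 ≤ 8 * (QD : ℝ) * Real.log m / m := by
    have := Real.log_nonneg hm1
    positivity
  have hextra : 0 ≤ 8 * (QD : ℝ) * (β + 2) * Real.log (nMax n₁ n₂ n₃ F) / 3 * (w t₀ / m) := by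
    have := hw t₀
    positivity
  have hsplit : 3 * (∑ e, (klDensity ν (p (Xstar e)) (p (t₀.tensor e))).toReal +
      lam * w t₀ / (m / N)) / N = 3 * ((∑ e, (klDensity ν (p (Xstar e))
        (p (t₀.tensor e))).toReal) / N + lam * (w t₀ / m)) := by
    field_simp
  rw [hsplit]
  simp only [w] at hextra ⊢
  linarith
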